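/- Let $\mathbb D=\{z\in\mathbb C:|z|<1\}$. For $f$ analytic in $\mathbb D$ and $0\le r<1$ put $M_p(r,f)=\left(\int_0^{2\pi}|f(re^{i\theta})|^p\,\frac{d\theta}{2\pi}\right)^{1/p}$ for $0<p<\infty$, $M_\infty(r,f)=\sup_{|z|=r}|f(z)|$, and $\|f\|_{H^p}=\sup_{0\le r<1}M_p(r,f)$. The Hardy space $H^p$ consists of the analytic $f$ with $\|f\|_{H^p}<\infty$. For a positive integer $N$ and $0\le l\le N-1$ let $I_{N,l}=\left[2\pi\frac{l}{N},2\pi\frac{l+1}{N}\right]$, and for $0<p<\infty$, $0<q\le\infty$, $0\le\rho\le1$ let $$\mathcal A_{p,q}(f,\rho,N)=\left\|\left\{\left(\int_{I_{N,l}}|f(\rho e^{i\theta})|^p\,\frac{d\theta}{2\pi}\right)^{1/p}\right\}_{l=0}^{N-1}\right\|_{\ell^q}\in[0,\infty],$$ where for $\rho=1$ the value $f(e^{i\theta})$ is the radial limit $\lim_{s\to1^-}f(se^{i\theta})$, and $\mathcal A_{p,q}(f,1,N)=\infty$ by convention if finite radial limits do not exist for almost every $\theta$. Put $1/\infty=0$,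 and write $\lfloor x\rfloor$ for the integer part of $x$. **Theorem.** Let $0<p<q\le\infty$. (a) There is a constant $C=C(p,q)>0$ such that $$M_q(r,f)\le\frac{C}{(\rho-r)^{\frac1p-\frac1q}}\,\mathcal A_{p,q}(f,\rho,N(r,\rho)),\qquad N(r,\rho)=\left\lfloor\frac1{\rho-r}\right\rfloor,$$ for all $0\le r<\rho\le1$ and all $f$ analytic in $\mathbb D$, where in the case $\rho=1$ it is assumed that $f\in H^p$. (b) For every integer $N\ge1$ and every $f\in H^p$, $\mathcal A_{p,q}(f,1,N)\le\|f\|_{H^p}$. (c) Nevertheless, $$\sup\frac{\|f\|_{H^p}}{\mathcal A_{p,q}(f,1,N)}=\infty,$$ the supremum being over all integers $N\ge1$ and all $f\in H^p$, $f\not\equiv0$. -/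

import Mathlib

open MeasureTheory Filter Topology Set
open scoped ENNReal NNReal

noncomputable section

namespace HardyAmalgam

/-- The normalized measure `dθ / (2π)` on the line of angles. -/
def angleMeasure : Measure ℝ := (ENNReal.ofReal (2 * Real.pi))⁻¹ • volume

/-- The integral mean `M_p(r, f)`, `0 < p ≤ ∞`, with values in `[0, ∞]`. -/
def integralMean (p : ℝ≥0∞) (r : ℝ) (f : ℂ → ℂ) : ℝ≥0∞ :=
  if p = ∞ then ⨆ z ∈ Metric.sphere (0 : ℂ) r, ‖f z‖ₑ
  else (∫⁻ θ in Icc 0 (2 * Real.pi), ‖f (circleMap 0 r θ)‖ₑ ^ p.toReal ∂angleMeasure)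
    ^ (1 / p.toReal)

/-- `‖f‖_{H^p} = sup_{0 ≤ r < 1} M_p(r, f)`, with values in `[0, ∞]`. -/
def hardyNorm (p : ℝ≥0∞) (f : ℂ → ℂ) : ℝ≥0∞ :=
  ⨆ r ∈ Ico (0 : ℝ) 1, integralMean p r f

/-- `f` is analytic in the open unit disc. Values of `f` off the disc play no role anywhere. -/
def AnalyticInDisc (f : ℂ → ℂ) : Prop := DifferentiableOn ℂ f (Metric.ball 0 1)

/-- Membership in the Hardy space `H^p`. -/
def MemHardy (p : ℝ≥0∞) (f : ℂ → ℂ) : Prop := AnalyticInDisc f ∧ hardyNorm p f < ∞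

/-- `f` has finite radial boundary values almost everywhere on the unit circle. -/
def HasBoundaryValues (f : ℂ → ℂ) : Prop :=
  ∀ᵐ θ ∂(volume.restrict (Icc 0 (2 * Real.pi))),
    ∃ w : ℂ, Tendsto (fun s : ℝ => f (circleMap 0 s θ)) (𝓝[<] 1) (𝓝 w)

/-- `f(ρ e^{iθ})` for `0 ≤ ρ ≤ 1`: for `ρ = 1` this is the radial limit. -/
def polarValue (f : ℂ → ℂ) (ρ θ : ℝ) : ℂ :=
  if ρ = 1 then limUnder (𝓝[<] (1 : ℝ)) (fun s : ℝ => f (circleMap 0 s θ))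
  else f (circleMap 0 ρ θ)

/-- The interval `I_{N,l} = [2π l / N, 2π (l + 1) / N]`. -/
def arc (N l : ℕ) : Set ℝ :=
  Icc (2 * Real.pi * ((l : ℝ) / N)) (2 * Real.pi * (((l : ℝ) + 1) / N))

/-- The local norm `(∫_{I_{N,l}} |f(ρ e^{iθ})|^p dθ / (2π))^{1/p}`, `0 < p < ∞`. -/
def localNorm (p : ℝ≥0∞) (f : ℂ → ℂ) (ρ : ℝ) (N l : ℕ) : ℝ≥0∞ :=
  (∫⁻ θ in arc N l, ‖polarValue f ρ θ‖ₑ ^ p.toReal ∂angleMeasure) ^ (1 / p.toReal)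

/-- The `ℓ^q` norm, `0 < q ≤ ∞`, of a finite sequence in `[0, ∞]`. -/
def lqNorm (q : ℝ≥0∞) {N : ℕ} (a : Fin N → ℝ≥0∞) : ℝ≥0∞ :=
  if q = ∞ then ⨆ l, a l else (∑ l, a l ^ q.toReal) ^ (1 / q.toReal)

open Classical in
/-- The `ℓ^q` norm of the local `L^p` norms of `f(ρ e^{iθ})` over the `N` arcs. It is `∞` when
`ρ = 1` and `f` does not have finite boundary values almost everywhere. -/
def amalgamNorm (p q : ℝ≥0∞) (f : ℂ → ℂ) (ρ : ℝ) (N : ℕ) : ℝ≥0∞ :=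
  if ρ = 1 ∧ ¬ HasBoundaryValues f then ∞
  else lqNorm q (fun l : Fin N => localNorm p f ρ N l)

end HardyAmalgam

end

/-!
The three parts of the theorem rest on two facts about an analytic function `f` in the disc.

*Poisson inequality.* For `0 < p < ∞` and `‖w‖ < ρ ≤ 1`, the value `|f w|^p` is at most the Poisson
integral of `|f|^p` over the circle of radius `ρ`. For `ρ < 1`, Mathlib's canonical decomposition of
`f` gives the Poisson–Jensen inequality for `log |f|`
(`log_norm_le_circleAverage_poissonKernel`), and Jensen's inequality for `exp` gives
`enorm_rpow_le_lintegral_poissonMeasure`. For `ρ = 1` and `f` in `H^p`, the functions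
`|f(s e^{iθ})|^(p/2)` are bounded in `L²`, hence uniformly integrable, so that the inequality for the
exponent `p/2` passes to the limit `s → 1`; the Cauchy–Schwarz inequality then gives the exponent
`p` (`enorm_rpow_le_lintegral_boundary`).

*Existence of radial limits in `H^p`.* For bounded `h`, a primitive `H` is Lipschitz on the disc and,
by Rademacher's theorem, differentiable along the circle at almost every `ζ`. After subtraction of
its linear part, `H` vanishes to first order at `ζ` along the circle, and the Poisson inequality
applied to the quotient by `z - ζ` shows that it does so in the whole disc; Cauchy's estimate for the
derivative gives the radial limit of `h`. For `f` in `H^p`, a limit of Herglotz integrals of `|f|^p`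
is an analytic `S` with `|f|^p ≤ Re S` (`exists_analytic_majorant`). Then `exp (-S)` and
`f exp (-S)` are bounded, and the radial limits of `exp (-S)` are almost everywhere nonzero because
all circle means of `Re S` equal `Re S 0`. Hence the quotient `f` has radial limits almost everywhere
(`ae_exists_radial_limit`). No factorization by Blaschke products is needed.

Part (b) follows from Fatou's lemma and `ℓ^p ⊆ ℓ^q`. Part (c) holds already for the constant
function `1`, for which the ratio is `N^(1/p - 1/q)`. For part (a), the arcs have length comparable
to `ρ - r`, so Harnack's inequality for the Poisson kernel shows that `|f|^p` on the circle of radius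
`r` is dominated by the Poisson integral of the step function of the arc averages of `|f|^p` on the
circle of radius `ρ`; the Poisson integral contracts the `L^(q/p)` norm
(`integralMean_le_lqNorm`).
-/

namespace HardyAmalgam

open Complex Metric Real MeromorphicOn

/-! ### The Poisson–Jensen inequality -/

lemma continuousOn_poissonKernel_sphere {R : ℝ} {w : ℂ} (hw : w ∈ ball (0 : ℂ) R) :
    ContinuousOn (poissonKernel 0 w) (sphere 0 |R|) := by
  rw [poissonKernel_eq_re_herglotzRieszKernel]
  exact Complex.continuous_re.comp_continuousOn (continuousOn_herglotzRieszKernel_sphere hw)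

/-- In the disc of radius `R`, the canonical factor `(R² - \bar u z) / (R (z - u))` is at least `1`
in absolute value: it is unimodular on the boundary circle and has a pole at `u`. -/
lemma one_le_norm_canonicalFactor {R : ℝ} {u w : ℂ} (hu : u ∈ ball (0 : ℂ) R)
    (hw : w ∈ ball (0 : ℂ) R) (huw : w ≠ u) : 1 ≤ ‖canonicalFactor R u w‖ := by
  have hR : 0 < R := pos_of_mem_ball hw
  simp only [mem_ball, dist_zero_right] at hu hw
  have hne : 0 < ‖w - u‖ := norm_pos_iff.2 (sub_ne_zero.2 huw)
  rw [canonicalFactor_apply, norm_div, le_div_iff₀ (by simp [hR.ne', hne]), one_mul,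
    norm_mul, norm_real, Real.norm_eq_abs, abs_of_pos hR]
  refine le_of_sq_le_sq ?_ (norm_nonneg _)
  rw [mul_pow]
  have e1 : ‖w - u‖ ^ 2 = (w.re - u.re) ^ 2 + (w.im - u.im) ^ 2 := by
    rw [← normSq_eq_norm_sq, normSq_apply]; simp; ring
  have e2 : ‖(R : ℂ) ^ 2 - (starRingEnd ℂ) u * w‖ ^ 2
      = (R ^ 2 - (u.re * w.re + u.im * w.im)) ^ 2 + (u.re * w.im - u.im * w.re) ^ 2 := by
    rw [← normSq_eq_norm_sq, normSq_apply, ← ofReal_pow]; simp [-ofReal_pow]; ring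
  have e3 : ‖w‖ ^ 2 = w.re ^ 2 + w.im ^ 2 := by
    rw [← normSq_eq_norm_sq, normSq_apply]; ring
  have e4 : ‖u‖ ^ 2 = u.re ^ 2 + u.im ^ 2 := by
    rw [← normSq_eq_norm_sq, normSq_apply]; ring
  have h1 : 0 ≤ (R ^ 2 - ‖w‖ ^ 2) * (R ^ 2 - ‖u‖ ^ 2) :=
    mul_nonneg (by nlinarith [norm_nonneg w]) (by nlinarith [norm_nonneg u])
  rw [e3, e4] at h1
  rw [e1, e2]
  nlinarith [h1]

/-- **Poisson–Jensen inequality**: `log |f|` is dominated by its Poisson integral. -/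
theorem log_norm_le_circleAverage_poissonKernel {R : ℝ} {f : ℂ → ℂ} {w : ℂ}
    (hf : AnalyticOnNhd ℂ f (closedBall 0 R)) (hw : w ∈ ball (0 : ℂ) R) (hfw : f w ≠ 0) :
    Real.log ‖f w‖ ≤ circleAverage (poissonKernel 0 w • (Real.log ‖f ·‖)) 0 R := by
  have hR : 0 < R := pos_of_mem_ball hw
  have hwc : w ∈ closedBall (0 : ℂ) R := ball_subset_closedBall hw
  have hconn : IsConnected (closedBall (0 : ℂ) R) := isConnected_closedBall hR.le
  have hord : ∀ z ∈ closedBall (0 : ℂ) R, f z ≠ 0 → meromorphicOrderAt f z = 0 := fun z hz h ↦ by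
    rw [(hf z hz).meromorphicOrderAt_eq, (hf z hz).analyticOrderAt_eq_zero.2 h]; rfl
  obtain ⟨h, D⟩ := hf.meromorphicOn.exists_ecanonicalDecomp
    ((hf.meromorphicOn.exists_meromorphicOrderAt_ne_top_iff_forall hconn).1
      ⟨⟨w, hwc⟩, by simp [hord w hwc hfw]⟩)
  have hfs : (divisor f (sphere 0 R)).support.Finite := divisor_sphere_support_finite
  set S := hfs.toFinset with hS
  set d : ℂ → ℝ := fun i ↦ (divisor f (sphere 0 R) i : ℝ) with hd
  have hsum : ∀ z : ℂ, ∑ᶠ i, d i * Real.log ‖z - i‖ = ∑ i ∈ S, d i * Real.log ‖z - i‖ := fun z ↦ by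
    refine finsum_eq_sum_of_support_subset _ fun i hi ↦ ?_
    simp only [hS, Finite.coe_toFinset, Function.mem_support] at hi ⊢
    intro h0
    simp [hd, h0] at hi
  have hSs : ∀ i ∈ S, i ∈ sphere (0 : ℂ) R := fun i hi ↦
    (divisor f (sphere 0 R)).supportWithinDomain (by simpa [hS] using hi)
  -- at zero-free points, `log |f|` is the sum of `log |h|`, of the contributions of the zeros on the
  -- circle, and of nonpositive contributions of the zeros inside, which vanish on the circle
  have key : ∀ z ∈ closedBall (0 : ℂ) R, f z ≠ 0 → Real.log ‖f z‖ = Real.log ‖h z‖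
      + ∑ i ∈ S, d i * Real.log ‖z - i‖
      - ∑ᶠ i, (divisor f (ball 0 R) i) * Real.log ‖canonicalFactor R i z‖ := fun z hz hfz ↦ by
    have := D.log_norm_eq hz (hord z hz hfz) hR
    rw [(hf z hz).meromorphicTrailingCoeffAt_of_ne_zero hfz] at this
    rw [← hsum]
    linarith
  have hcirc : (poissonKernel 0 w • (Real.log ‖f ·‖)) =ᶠ[codiscreteWithin (sphere (0 : ℂ) |R|)]
      fun z ↦ (poissonKernel 0 w • (Real.log ‖h ·‖)) z
        + ∑ i ∈ S, d i * (poissonKernel 0 w • (Real.log ‖· - i‖)) z := by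
    have h1 := codiscreteWithin_mono (sphere_subset_closedBall (x := (0 : ℂ)) (ε := |R|))
      (AnalyticOnNhd.preimage_zero_mem_codiscreteWithin (by rwa [abs_of_pos hR]) hfw
        (by rwa [abs_of_pos hR]) (by rwa [abs_of_pos hR]))
    filter_upwards [h1, self_mem_codiscreteWithin (sphere (0 : ℂ) |R|)] with z hz hzs
    have hz' : f z ≠ 0 := by simpa using hz
    rw [abs_of_pos hR] at hzs
    have h0 : ∑ᶠ i, (divisor f (ball 0 R) i) * Real.log ‖canonicalFactor R i z‖ = 0 := by
      rw [← finsum_zero (α := ℂ) (M := ℝ)]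
      refine finsum_congr fun i ↦ ?_
      by_cases hi : i ∈ ball (0 : ℂ) R
      · simp [norm_canonicalFactor_eval_circle_eq_one hi hzs]
      · simp [hi]
    simp only [Pi.smul_apply', smul_eq_mul]
    rw [key z (sphere_subset_closedBall hzs) hz', h0, sub_zero, mul_add, Finset.mul_sum]
    congr 1
    exact Finset.sum_congr rfl fun i _ ↦ by ring
  have hPh : CircleIntegrable (poissonKernel 0 w • (Real.log ‖h ·‖)) 0 R :=
    CircleIntegrable.continuousOn_smul
      (MeromorphicOn.circleIntegrable_log_norm (D.analyticOnNhd.meromorphicOn.mono_set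
        (by rw [abs_of_pos hR]; exact sphere_subset_closedBall)))
      (continuousOn_poissonKernel_sphere hw)
  have hPi : ∀ i, CircleIntegrable (poissonKernel 0 w • (Real.log ‖· - i‖)) 0 R := fun i ↦
    CircleIntegrable.continuousOn_smul (circleIntegrable_log_norm_sub_const R)
      (continuousOn_poissonKernel_sphere hw)
  have hPi' : ∀ i ∈ S, CircleIntegrable
      (fun z ↦ d i * (poissonKernel 0 w • (Real.log ‖· - i‖)) z) 0 R := fun i _ ↦
    (hPi i).const_mul (d i)
  rw [circleAverage_congr_codiscreteWithin hcirc hR.ne',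
    circleAverage_fun_add hPh (CircleIntegrable.fun_sum S hPi'), circleAverage_fun_sum hPi']
  have e1 : circleAverage (poissonKernel 0 w • (Real.log ‖h ·‖)) 0 R = Real.log ‖h w‖ :=
    InnerProductSpace.HarmonicOnNhd.circleAverage_poissonKernel_smul
      (fun z hz ↦ (D.analyticOnNhd z hz).harmonicAt_log_norm (D.ne_zero z hz)) hw
  have e2 : ∀ i ∈ S, circleAverage (fun z ↦ d i * (poissonKernel 0 w • (Real.log ‖· - i‖)) z) 0 R
      = d i * Real.log ‖w - i‖ := fun i hi ↦ by
    rw [← circleAverage_re_herglotzRieszKernel_mul_log (hSs i hi) hw,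
      ← poissonKernel_eq_re_herglotzRieszKernel, ← smul_eq_mul, ← circleAverage_fun_smul]
    rfl
  rw [e1, Finset.sum_congr rfl e2, key w hwc hfw]
  have h0 : 0 ≤ ∑ᶠ i, (divisor f (ball 0 R) i) * Real.log ‖canonicalFactor R i w‖ := by
    refine finsum_nonneg fun i ↦ ?_
    have hdn : (0 : ℝ) ≤ divisor f (ball 0 R) i := by
      exact_mod_cast (AnalyticOnNhd.divisor_nonneg (hf.mono ball_subset_closedBall)) i
    by_cases hi : i ∈ ball (0 : ℂ) R
    · rcases eq_or_ne w i with rfl | hwi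
      · simp
      · exact mul_nonneg hdn (Real.log_nonneg (one_le_norm_canonicalFactor hi hw hwi))
    · simp [hi]
  linarith

/-! ### Poisson measures and the subharmonicity of powers -/

/-- The normalized arc length measure on one period `[0, 2π]` of the angle. -/
noncomputable def circleMeasure : Measure ℝ := angleMeasure.restrict (Icc 0 (2 * π))

/-- Harmonic measure of the disc of radius `R` seen from `w`, in terms of the angle: the density is
the Poisson kernel. It is a probability measure if `‖w‖ < R`. -/
noncomputable def poissonMeasure (R : ℝ) (w : ℂ) : Measure ℝ :=
  circleMeasure.withDensity fun θ ↦ ENNReal.ofReal (poissonKernel 0 w (circleMap 0 R θ))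

lemma circleMeasure_eq :
    circleMeasure = (ENNReal.ofReal (2 * π))⁻¹ • volume.restrict (Icc 0 (2 * π)) := by
  rw [circleMeasure, angleMeasure, Measure.restrict_smul]

lemma ofReal_two_pi_ne_zero : ENNReal.ofReal (2 * π) ≠ 0 := by
  simp [Real.pi_pos]

instance : IsProbabilityMeasure circleMeasure where
  measure_univ := by
    rw [circleMeasure_eq, Measure.smul_apply, Measure.restrict_apply_univ, Real.volume_Icc,
      sub_zero, smul_eq_mul, ENNReal.inv_mul_cancel ofReal_two_pi_ne_zero ENNReal.ofReal_ne_top]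

lemma ae_circleMeasure_iff {P : ℝ → Prop} :
    (∀ᵐ θ ∂circleMeasure, P θ) ↔ ∀ᵐ θ ∂(volume.restrict (Icc 0 (2 * π))), P θ := by
  rw [circleMeasure_eq]
  exact Measure.ae_ennreal_smul_measure_iff (ENNReal.inv_ne_zero.2 ENNReal.ofReal_ne_top)

lemma circleIntegrable_iff_integrable {E : Type*} [NormedAddCommGroup E] {g : ℂ → E} {R : ℝ} :
    CircleIntegrable g 0 R ↔ Integrable (fun θ ↦ g (circleMap 0 R θ)) circleMeasure := by
  rw [CircleIntegrable, intervalIntegrable_iff, uIoc_of_le Real.two_pi_pos.le, circleMeasure_eq,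
    integrable_smul_measure (ENNReal.inv_ne_zero.2 ENNReal.ofReal_ne_top)
      (ENNReal.inv_ne_top.2 ofReal_two_pi_ne_zero), ← integrableOn_Icc_iff_integrableOn_Ioc]
  rfl

lemma circleAverage_eq_integral {E : Type*} [NormedAddCommGroup E] [NormedSpace ℝ E] (g : ℂ → E)
    (R : ℝ) : circleAverage g 0 R = ∫ θ, g (circleMap 0 R θ) ∂circleMeasure := by
  rw [circleAverage_def, circleMeasure_eq, integral_smul_measure,
    intervalIntegral.integral_of_le Real.two_pi_pos.le, integral_Icc_eq_integral_Ioc,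
    ENNReal.toReal_inv, ENNReal.toReal_ofReal Real.two_pi_pos.le]

section PoissonInequality

variable {R : ℝ} {w : ℂ}

lemma poissonKernel_circleMap (hR : 0 < R) (w : ℂ) (θ : ℝ) :
    poissonKernel 0 w (circleMap 0 R θ) = (R ^ 2 - ‖w‖ ^ 2) / ‖circleMap 0 R θ - w‖ ^ 2 := by
  simp [poissonKernel_def, abs_of_pos hR]

lemma poissonKernel_circleMap_nonneg (hw : w ∈ ball (0 : ℂ) R) (θ : ℝ) :
    0 ≤ poissonKernel 0 w (circleMap 0 R θ) := by
  have hR : 0 < R := pos_of_mem_ball hw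
  rw [poissonKernel_circleMap hR]
  rw [mem_ball, dist_zero_right] at hw
  have := norm_nonneg w
  exact div_nonneg (by nlinarith) (by positivity)

lemma poissonKernel_circleMap_le (hw : w ∈ ball (0 : ℂ) R) (θ : ℝ) :
    poissonKernel 0 w (circleMap 0 R θ) ≤ (R + ‖w‖) / (R - ‖w‖) := by
  have hR : 0 < R := pos_of_mem_ball hw
  have h := re_herglotzRieszKernel_le (circleMap_mem_sphere (0 : ℂ) hR.le θ) hw
  simpa [poissonKernel_eq_re_herglotzRieszKernel, herglotzRieszKernel_def] using h

lemma continuous_poissonKernel_circleMap (hw : w ∈ ball (0 : ℂ) R) :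
    Continuous fun θ ↦ poissonKernel 0 w (circleMap 0 R θ) :=
  (continuousOn_poissonKernel_sphere hw).comp_continuous (continuous_circleMap 0 R)
    fun θ ↦ circleMap_mem_sphere' 0 R θ

lemma integrable_of_continuous {E : Type*} [NormedAddCommGroup E] {g : ℝ → E} (hg : Continuous g) :
    Integrable g circleMeasure := by
  rw [circleMeasure_eq]
  exact (hg.integrableOn_Icc).smul_measure (ENNReal.inv_ne_top.2 ofReal_two_pi_ne_zero)

lemma isProbabilityMeasure_poissonMeasure (hw : w ∈ ball (0 : ℂ) R) :
    IsProbabilityMeasure (poissonMeasure R w) where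
  measure_univ := by
    rw [poissonMeasure, withDensity_apply _ MeasurableSet.univ, Measure.restrict_univ,
      ← ofReal_integral_eq_lintegral_ofReal
        (integrable_of_continuous (continuous_poissonKernel_circleMap hw))
        (ae_of_all _ (poissonKernel_circleMap_nonneg hw)),
      ← circleAverage_eq_integral]
    have h := InnerProductSpace.HarmonicOnNhd.circleAverage_poissonKernel_smul
      (f := fun _ ↦ (1 : ℝ)) (c := 0) (R := R) (w := w)
      (fun z _ ↦ InnerProductSpace.harmonicAt_const 1) hw
    have e : poissonKernel 0 w • (fun _ : ℂ ↦ (1 : ℝ)) = poissonKernel 0 w := by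
      ext z; simp
    rw [e] at h
    simp [h]

lemma poissonMeasure_absolutelyContinuous : poissonMeasure R w ≪ circleMeasure :=
  withDensity_absolutelyContinuous _ _

lemma lintegral_poissonMeasure (hw : w ∈ ball (0 : ℂ) R) (g : ℝ → ℝ≥0∞) :
    ∫⁻ θ, g θ ∂poissonMeasure R w =
      ∫⁻ θ, ENNReal.ofReal (poissonKernel 0 w (circleMap 0 R θ)) * g θ ∂circleMeasure :=
  lintegral_withDensity_eq_lintegral_mul_non_measurable _
    (continuous_poissonKernel_circleMap hw).measurable.ennreal_ofReal
    (ae_of_all _ fun _ ↦ ENNReal.ofReal_lt_top) _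

lemma integral_poissonMeasure (hw : w ∈ ball (0 : ℂ) R) (g : ℂ → ℝ) :
    ∫ θ, g (circleMap 0 R θ) ∂poissonMeasure R w = circleAverage (poissonKernel 0 w • g) 0 R := by
  rw [poissonMeasure, integral_withDensity_eq_integral_toReal_smul
    (continuous_poissonKernel_circleMap hw).measurable.ennreal_ofReal
    (ae_of_all _ fun _ ↦ ENNReal.ofReal_lt_top), circleAverage_eq_integral]
  refine integral_congr_ae (ae_of_all _ fun θ ↦ ?_)
  simp [ENNReal.toReal_ofReal (poissonKernel_circleMap_nonneg hw θ)]

lemma integrable_poissonMeasure (hw : w ∈ ball (0 : ℂ) R) {g : ℂ → ℝ} (hg : CircleIntegrable g 0 R) :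
    Integrable (fun θ ↦ g (circleMap 0 R θ)) (poissonMeasure R w) := by
  rw [poissonMeasure, integrable_withDensity_iff_integrable_smul'
    (continuous_poissonKernel_circleMap hw).measurable.ennreal_ofReal
    (ae_of_all _ fun _ ↦ ENNReal.ofReal_lt_top)]
  have := circleIntegrable_iff_integrable.1
    (hg.continuousOn_smul (continuousOn_poissonKernel_sphere hw))
  refine this.congr (ae_of_all _ fun θ ↦ ?_)
  simp [ENNReal.toReal_ofReal (poissonKernel_circleMap_nonneg hw θ)]

/-- An analytic function that does not vanish identically has almost no zeros on a circle. -/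
lemma ae_circleMeasure_ne_zero {f : ℂ → ℂ} (hf : AnalyticOnNhd ℂ f (closedBall 0 R))
    (hw : w ∈ ball (0 : ℂ) R) (hfw : f w ≠ 0) :
    ∀ᵐ θ ∂circleMeasure, f (circleMap 0 R θ) ≠ 0 := by
  have hR : 0 < R := pos_of_mem_ball hw
  have h1 := codiscreteWithin_mono (sphere_subset_closedBall (x := (0 : ℂ)) (ε := |R|))
    (AnalyticOnNhd.preimage_zero_mem_codiscreteWithin (by rwa [abs_of_pos hR]) hfw
      (by rw [abs_of_pos hR]; exact ball_subset_closedBall hw)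
      (by rw [abs_of_pos hR]; exact isConnected_closedBall hR.le))
  have h2 : ∀ᵐ θ ∂(volume.restrict (Icc 0 (2 * π))), circleMap 0 R θ ∈ f ⁻¹' {0}ᶜ :=
    ae_restrict_le_codiscreteWithin measurableSet_Icc
      (codiscreteWithin_mono (subset_univ (Icc 0 (2 * π))) (circleMap_preimage_codiscrete hR.ne' h1))
  rw [ae_circleMeasure_iff]
  exact h2

/-- The powers `|f|^s`, `s > 0`, of an analytic function are subharmonic: they are dominated by
their Poisson integrals. This is Jensen's inequality for the exponential function, applied to the
Poisson–Jensen inequality. -/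
theorem enorm_rpow_le_lintegral_poissonMeasure {f : ℂ → ℂ} {s : ℝ} (hs : 0 < s)
    (hf : AnalyticOnNhd ℂ f (closedBall 0 R)) (hw : w ∈ ball (0 : ℂ) R) :
    ‖f w‖ₑ ^ s ≤ ∫⁻ θ, ‖f (circleMap 0 R θ)‖ₑ ^ s ∂poissonMeasure R w := by
  by_cases hfw : f w = 0
  · simp [hfw, hs]
  have hR : 0 < R := pos_of_mem_ball hw
  have := isProbabilityMeasure_poissonMeasure hw
  set u : ℂ → ℝ := fun z ↦ Real.log ‖f z‖ with hu
  have hui : Integrable (fun θ ↦ u (circleMap 0 R θ)) (poissonMeasure R w) :=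
    integrable_poissonMeasure hw (MeromorphicOn.circleIntegrable_log_norm
      ((hf.mono (by rw [abs_of_pos hR]; exact sphere_subset_closedBall)).meromorphicOn))
  have hcont : ContinuousOn (fun z ↦ ‖f z‖ ^ s) (sphere 0 R) :=
    ((hf.continuousOn.mono sphere_subset_closedBall).norm).rpow_const fun _ _ ↦ Or.inr hs.le
  have hgi : Integrable (fun θ ↦ ‖f (circleMap 0 R θ)‖ ^ s) (poissonMeasure R w) :=
    integrable_poissonMeasure (g := fun z ↦ ‖f z‖ ^ s) hw (hcont.circleIntegrable hR.le)
  have hae : (fun θ ↦ Real.exp (s * u (circleMap 0 R θ)))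
      =ᵐ[poissonMeasure R w] fun θ ↦ ‖f (circleMap 0 R θ)‖ ^ s := by
    filter_upwards [poissonMeasure_absolutelyContinuous.ae_le (ae_circleMeasure_ne_zero hf hw hfw)]
      with θ hθ
    rw [Real.rpow_def_of_pos (norm_pos_iff.2 hθ), mul_comm]
  have h1 : Real.log ‖f w‖ ≤ ∫ θ, u (circleMap 0 R θ) ∂poissonMeasure R w := by
    rw [integral_poissonMeasure hw u]
    exact log_norm_le_circleAverage_poissonKernel hf hw hfw
  have h2 := convexOn_exp.map_integral_le (μ := poissonMeasure R w) Real.continuous_exp.continuousOn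
    isClosed_univ (f := fun θ ↦ s * u (circleMap 0 R θ)) (ae_of_all _ fun _ ↦ mem_univ _)
    (hui.const_mul s) (hgi.congr hae.symm)
  have h3 : ‖f w‖ ^ s ≤ ∫ θ, ‖f (circleMap 0 R θ)‖ ^ s ∂poissonMeasure R w := by
    rw [← integral_congr_ae hae]
    refine le_trans ?_ h2
    rw [Real.rpow_def_of_pos (norm_pos_iff.2 hfw), integral_const_mul, mul_comm]
    gcongr
  have e : ∀ z : ℂ, ‖z‖ₑ ^ s = ENNReal.ofReal (‖z‖ ^ s) := fun z ↦ by
    rw [← ofReal_norm, ENNReal.ofReal_rpow_of_nonneg (norm_nonneg z) hs.le]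
  simp_rw [e]
  rw [← ofReal_integral_eq_lintegral_ofReal hgi (ae_of_all _ fun _ ↦ by positivity)]
  exact ENNReal.ofReal_le_ofReal h3

/-! ### The Poisson inequality for boundary values -/

lemma circleMap_mem_ball {s : ℝ} (hs : s ∈ Ico (0 : ℝ) 1) (θ : ℝ) :
    circleMap 0 s θ ∈ ball (0 : ℂ) 1 := by
  simp [abs_of_nonneg hs.1, hs.2]

lemma continuous_comp_circleMap {f : ℂ → ℂ} (hf : AnalyticInDisc f) {s : ℝ}
    (hs : s ∈ Ico (0 : ℝ) 1) : Continuous fun θ ↦ f (circleMap 0 s θ) :=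
  hf.continuousOn.comp_continuous (continuous_circleMap 0 s) (circleMap_mem_ball hs)

lemma analyticOnNhd_closedBall {f : ℂ → ℂ} (hf : AnalyticInDisc f) {R : ℝ} (hR : R < 1) :
    AnalyticOnNhd ℂ f (closedBall 0 R) :=
  (hf.analyticOnNhd isOpen_ball).mono (closedBall_subset_ball hR)

lemma eventually_mem_Ioo {a : ℝ} (ha : a < 1) : ∀ᶠ s in 𝓝[<] (1 : ℝ), s ∈ Ioo a 1 :=
  Ioo_mem_nhdsLT ha

lemma tendsto_one_sub_inv :
    Tendsto (fun n : ℕ ↦ (1 : ℝ) - 1 / ((n : ℝ) + 1)) atTop (𝓝[<] 1) := by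
  refine tendsto_nhdsWithin_iff.2 ⟨?_, Eventually.of_forall fun n ↦ ?_⟩
  · simpa using (tendsto_const_nhds (x := (1 : ℝ))).sub (tendsto_one_div_add_atTop_nhds_zero_nat)
  · have : (0 : ℝ) < 1 / ((n : ℝ) + 1) := by positivity
    simpa using this

lemma one_sub_inv_mem_Ico (n : ℕ) : (1 : ℝ) - 1 / ((n : ℝ) + 1) ∈ Ico (0 : ℝ) 1 := by
  have h1 : (0 : ℝ) < 1 / ((n : ℝ) + 1) := by positivity
  have h2 : 1 / ((n : ℝ) + 1) ≤ 1 := by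
    rw [div_le_one (by positivity)]; linarith [Nat.cast_nonneg (α := ℝ) n]
  exact ⟨by linarith, by linarith⟩

lemma aemeasurable_of_radial_limit {f : ℂ → ℂ} (hf : AnalyticInDisc f) {g : ℝ → ℂ} {μ : Measure ℝ}
    (hg : ∀ᵐ θ ∂μ, Tendsto (fun s : ℝ ↦ f (circleMap 0 s θ)) (𝓝[<] 1) (𝓝 (g θ))) :
    AEMeasurable g μ :=
  aemeasurable_of_tendsto_metrizable_ae (f := fun (n : ℕ) θ ↦ f (circleMap 0 (1 - 1 / ((n : ℝ) + 1)) θ))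
    atTop (fun n ↦ (continuous_comp_circleMap hf (one_sub_inv_mem_Ico n)).measurable.aemeasurable)
    (hg.mono fun _ h ↦ h.comp tendsto_one_sub_inv)

/-- The Poisson inequality for `|f|^(p/2)`. The functions `|f(s e^{iθ})|^(p/2)` are bounded in `L²`,
so they are uniformly integrable, and the inequality on the circles of radius `s` passes to the
limit; uniform integrability is used in the form `x ≤ min x M + x² / M`. -/
lemma enorm_rpow_half_le_lintegral_boundary {f : ℂ → ℂ} {g : ℝ → ℂ} {p : ℝ} (hp : 0 < p)
    (hf : AnalyticInDisc f) {A : ℝ≥0∞} (hA : A ≠ ∞)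
    (hbd : ∀ r ∈ Ico (0 : ℝ) 1, ∫⁻ θ, ‖f (circleMap 0 r θ)‖ₑ ^ p ∂circleMeasure ≤ A)
    (hg : ∀ᵐ θ ∂circleMeasure, Tendsto (fun s : ℝ ↦ f (circleMap 0 s θ)) (𝓝[<] 1) (𝓝 (g θ)))
    (hw : w ∈ ball (0 : ℂ) 1) :
    ‖f w‖ₑ ^ (p / 2) ≤ ∫⁻ θ, ‖g θ‖ₑ ^ (p / 2) ∂poissonMeasure 1 w := by
  have hp2 : 0 < p / 2 := by positivity
  have hw' : ‖w‖ < 1 := by simpa using hw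
  set P : ℝ → ℝ → ℝ≥0∞ := fun s θ ↦ ENNReal.ofReal (poissonKernel 0 w (circleMap 0 s θ)) with hP
  set G : ℝ → ℝ → ℝ≥0∞ := fun s θ ↦ ‖f (circleMap 0 s θ)‖ₑ ^ (p / 2) with hG
  set C : ℝ≥0∞ := ENNReal.ofReal (2 / ((1 - ‖w‖) / 2)) with hC
  have hev : ∀ᶠ s in 𝓝[<] (1 : ℝ), s ∈ Ioo ((1 + ‖w‖) / 2) 1 := eventually_mem_Ioo (by linarith)
  have hsw : ∀ s ∈ Ioo ((1 + ‖w‖) / 2) (1 : ℝ), w ∈ ball (0 : ℂ) s := fun s hs ↦ by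
    rw [mem_ball, dist_zero_right]; linarith [hs.1, norm_nonneg w]
  have hs0 : ∀ s ∈ Ioo ((1 + ‖w‖) / 2) (1 : ℝ), s ∈ Ico (0 : ℝ) 1 := fun s hs ↦
    ⟨by linarith [hs.1, norm_nonneg w], hs.2⟩
  have hPC : ∀ s ∈ Ioo ((1 + ‖w‖) / 2) (1 : ℝ), ∀ θ, P s θ ≤ C := fun s hs θ ↦ by
    refine ENNReal.ofReal_le_ofReal ((poissonKernel_circleMap_le (hsw s hs) θ).trans ?_)
    have := hs.1; have := hs.2
    gcongr <;> linarith
  have hGm : ∀ s ∈ Ioo ((1 + ‖w‖) / 2) (1 : ℝ), Measurable (G s) := fun s hs ↦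
    ((continuous_comp_circleMap hf (hs0 s hs)).enorm.measurable).pow_const _
  have hPm : ∀ s ∈ Ioo ((1 + ‖w‖) / 2) (1 : ℝ), Measurable (P s) := fun s hs ↦
    (continuous_poissonKernel_circleMap (hsw s hs)).measurable.ennreal_ofReal
  have hGsq : ∀ s θ, G s θ * G s θ = ‖f (circleMap 0 s θ)‖ₑ ^ p := fun s θ ↦ by
    rw [hG, ← ENNReal.rpow_add_of_nonneg _ _ hp2.le hp2.le, add_halves]
  -- the truncation at the level `M = k + 1` costs at most `C * A / M`, uniformly in `s`
  have htrunc : ∀ k : ℕ, ∀ s ∈ Ioo ((1 + ‖w‖) / 2) (1 : ℝ), ‖f w‖ₑ ^ (p / 2) ≤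
      (∫⁻ θ, P s θ * min (G s θ) (k + 1) ∂circleMeasure) + C * A / (k + 1) := fun k s hs ↦ by
    have hk0 : ((k : ℝ≥0∞) + 1) ≠ 0 := by simp
    have hkt : ((k : ℝ≥0∞) + 1) ≠ ∞ := by simp
    calc ‖f w‖ₑ ^ (p / 2)
        ≤ ∫⁻ θ, P s θ * G s θ ∂circleMeasure := by
          rw [← lintegral_poissonMeasure (hsw s hs)]
          exact enorm_rpow_le_lintegral_poissonMeasure hp2 (analyticOnNhd_closedBall hf hs.2)
            (hsw s hs)
      _ ≤ ∫⁻ θ, (P s θ * min (G s θ) (k + 1)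
            + C / (k + 1) * ‖f (circleMap 0 s θ)‖ₑ ^ p) ∂circleMeasure := by
          refine lintegral_mono fun θ ↦ ?_
          rw [← hGsq]
          rcases le_total (G s θ) (k + 1) with h | h
          · rw [min_eq_left h]; exact le_self_add
          · refine le_add_of_nonneg_of_le zero_le ?_
            calc P s θ * G s θ ≤ C * (G s θ * ((k + 1) / (k + 1))) := by
                  rw [ENNReal.div_self hk0 hkt, mul_one]; gcongr; exact hPC s hs θ
              _ ≤ C * (G s θ * (G s θ / (k + 1))) := by gcongr
              _ = C / (k + 1) * (G s θ * G s θ) := by simp only [div_eq_mul_inv]; ring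
      _ = (∫⁻ θ, P s θ * min (G s θ) (k + 1) ∂circleMeasure)
            + C / (k + 1) * ∫⁻ θ, ‖f (circleMap 0 s θ)‖ₑ ^ p ∂circleMeasure := by
          have hm : Measurable fun θ ↦ P s θ * min (G s θ) ((k : ℝ≥0∞) + 1) :=
            (hPm s hs).mul ((hGm s hs).min measurable_const)
          rw [lintegral_add_left hm,
            lintegral_const_mul' _ _ (ENNReal.div_ne_top ENNReal.ofReal_ne_top hk0)]
      _ ≤ _ := by
          have : C * A / (k + 1) = C / (k + 1) * A := by simp only [div_eq_mul_inv]; ring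
          rw [this]
          gcongr
          exact hbd s (hs0 s hs)
  -- dominated convergence applies to the truncated functions
  have hlim : ∀ k : ℕ, Tendsto (fun s ↦ ∫⁻ θ, P s θ * min (G s θ) (k + 1) ∂circleMeasure) (𝓝[<] 1)
      (𝓝 (∫⁻ θ, P 1 θ * min (‖g θ‖ₑ ^ (p / 2)) (k + 1) ∂circleMeasure)) := fun k ↦ by
    refine tendsto_lintegral_filter_of_dominated_convergence (fun _ ↦ C * (k + 1))
      (hev.mono fun s hs ↦ (hPm s hs).mul ((hGm s hs).min measurable_const))
      (hev.mono fun s hs ↦ ae_of_all _ fun θ ↦ mul_le_mul' (hPC s hs θ) (min_le_right _ _)) ?_ ?_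
    · rw [lintegral_const]
      exact ENNReal.mul_ne_top (ENNReal.mul_ne_top ENNReal.ofReal_ne_top (by simp)) (by simp)
    · filter_upwards [hg] with θ hθ
      have hPt : Tendsto (fun s ↦ P s θ) (𝓝[<] 1) (𝓝 (P 1 θ)) := by
        refine (ENNReal.continuous_ofReal.tendsto _).comp ?_
        have hne : circleMap 0 1 θ ≠ w := by
          intro h; rw [← h] at hw'; simp at hw'
        have hne' : ‖circleMap 0 1 θ - w‖ ^ 2 ≠ 0 :=
          pow_ne_zero _ (norm_ne_zero_iff.2 (sub_ne_zero.2 hne))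
        have hc : Continuous fun s : ℝ ↦ circleMap 0 s θ := by
          unfold circleMap; fun_prop
        have : ContinuousAt (fun s : ℝ ↦ poissonKernel 0 w (circleMap 0 s θ)) 1 := by
          simp only [poissonKernel_def, sub_zero]
          exact ContinuousAt.div (by fun_prop) (by fun_prop) hne'
        exact this.tendsto.mono_left nhdsWithin_le_nhds
      have hGt : Tendsto (fun s ↦ min (G s θ) ((k : ℝ≥0∞) + 1)) (𝓝[<] 1)
          (𝓝 (min (‖g θ‖ₑ ^ (p / 2)) (k + 1))) :=
        ((ENNReal.continuous_rpow_const.tendsto _).comp hθ.enorm).min tendsto_const_nhds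
      refine ENNReal.Tendsto.mul hPt (Or.inr ?_) hGt (Or.inr ENNReal.ofReal_ne_top)
      exact ne_top_of_le_ne_top (by simp) (min_le_right _ _)
  have hle : ∀ k : ℕ, ‖f w‖ₑ ^ (p / 2) ≤
      (∫⁻ θ, ‖g θ‖ₑ ^ (p / 2) ∂poissonMeasure 1 w) + C * A / (k + 1) := fun k ↦ by
    have h := ge_of_tendsto ((hlim k).add_const (C * A / (k + 1)))
      (hev.mono fun s hs ↦ htrunc k s hs)
    refine h.trans ?_
    rw [lintegral_poissonMeasure hw]
    gcongr
    exact min_le_left _ _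
  have herr : Tendsto (fun k : ℕ ↦ (∫⁻ θ, ‖g θ‖ₑ ^ (p / 2) ∂poissonMeasure 1 w) + C * A / (k + 1))
      atTop (𝓝 ((∫⁻ θ, ‖g θ‖ₑ ^ (p / 2) ∂poissonMeasure 1 w) + 0)) := by
    refine tendsto_const_nhds.add ?_
    have h := ENNReal.Tendsto.const_div (a := C * A)
      ((ENNReal.tendsto_nat_nhds_top).comp (tendsto_add_atTop_nat 1))
      (Or.inr (ENNReal.mul_ne_top ENNReal.ofReal_ne_top hA))
    simpa [Function.comp_def] using h
  simpa using ge_of_tendsto herr (Eventually.of_forall hle)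

/-- For `f` in `H^p`, the power `|f|^p` is dominated by the Poisson integral of the `p`-th power of
its boundary values. -/
theorem enorm_rpow_le_lintegral_boundary {f : ℂ → ℂ} {g : ℝ → ℂ} {p : ℝ} (hp : 0 < p)
    (hf : AnalyticInDisc f) {A : ℝ≥0∞} (hA : A ≠ ∞)
    (hbd : ∀ r ∈ Ico (0 : ℝ) 1, ∫⁻ θ, ‖f (circleMap 0 r θ)‖ₑ ^ p ∂circleMeasure ≤ A)
    (hg : ∀ᵐ θ ∂circleMeasure, Tendsto (fun s : ℝ ↦ f (circleMap 0 s θ)) (𝓝[<] 1) (𝓝 (g θ)))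
    (hw : w ∈ ball (0 : ℂ) 1) :
    ‖f w‖ₑ ^ p ≤ ∫⁻ θ, ‖g θ‖ₑ ^ p ∂poissonMeasure 1 w := by
  have := isProbabilityMeasure_poissonMeasure hw
  have h := enorm_rpow_half_le_lintegral_boundary hp hf hA hbd hg hw
  have hgm : AEMeasurable (fun θ ↦ ‖g θ‖ₑ ^ (p / 2)) (poissonMeasure 1 w) :=
    ((aemeasurable_of_radial_limit hf hg).mono_ac
      poissonMeasure_absolutelyContinuous).enorm.pow_const _
  have hCS := ENNReal.lintegral_mul_le_Lp_mul_Lq (poissonMeasure 1 w) Real.HolderConjugate.two_two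
    hgm (aemeasurable_const (b := (1 : ℝ≥0∞)))
  have e : ∀ x : ℝ≥0∞, (x ^ (p / 2)) ^ (2 : ℝ) = x ^ p := fun x ↦ by
    rw [← ENNReal.rpow_mul]; congr 1; ring
  simp only [Pi.mul_apply, mul_one, ENNReal.one_rpow, lintegral_const, measure_univ, e] at hCS
  rw [← e ‖f w‖ₑ]
  calc (‖f w‖ₑ ^ (p / 2)) ^ (2 : ℝ)
      ≤ ((∫⁻ θ, ‖g θ‖ₑ ^ p ∂poissonMeasure 1 w) ^ (1 / 2 : ℝ)) ^ (2 : ℝ) :=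
        ENNReal.rpow_le_rpow (h.trans hCS) (by norm_num)
    _ = _ := by rw [← ENNReal.rpow_mul]; norm_num

end PoissonInequality

/-! ### Fatou's theorem for bounded analytic functions -/

lemma circleMeasure_absolutelyContinuous : circleMeasure ≪ volume := by
  rw [circleMeasure_eq]
  exact (Measure.absolutelyContinuous_of_le Measure.restrict_le_self).smul_left _

/-- If `E` vanishes to first order along the circle, as a function of the angle, then it does so
as a function of the point on the circle. -/
lemma isLittleO_sphere_of_hasDerivAt {E : ℂ → ℂ} {t : ℝ} (h0 : E (circleMap 0 1 t) = 0)
    (hE : HasDerivAt (fun θ ↦ E (circleMap 0 1 θ)) 0 t) :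
    E =o[𝓝[sphere 0 1] (circleMap 0 1 t)] fun z ↦ z - circleMap 0 1 t := by
  set ζ := circleMap 0 1 t with hζ
  have hζ0 : ζ ≠ 0 := circleMap_ne_center one_ne_zero
  have hζ1 : ‖ζ‖ = 1 := by simp [hζ]
  -- `τ z` is the angle of a point `z` of the circle near `ζ`; it is Lipschitz at `ζ`
  set τ : ℂ → ℝ := fun z ↦ t + (Complex.log (z / ζ)).im with hτ
  have hlog : HasDerivAt (fun z ↦ Complex.log (z / ζ)) (1 / ζ / (ζ / ζ)) ζ := by
    refine ((hasDerivAt_id ζ).div_const ζ).clog ?_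
    simp [hζ0]
  have hO : (fun z ↦ τ z - t) =O[𝓝 ζ] fun z ↦ z - ζ := by
    have h := hlog.isBigO_sub
    refine Asymptotics.IsBigO.trans (Asymptotics.isBigO_of_le _ fun z ↦ ?_) h
    simp only [hτ, add_sub_cancel_left, div_self hζ0, Complex.log_one, sub_zero, Real.norm_eq_abs]
    exact Complex.abs_im_le_norm _
  have hτt : Tendsto τ (𝓝 ζ) (𝓝 t) := by
    have h := (Complex.continuous_im.continuousAt.comp hlog.continuousAt).tendsto
    have h' := h.const_add t
    simpa [hζ0] using h'
  have ho : (fun z ↦ E (circleMap 0 1 (τ z))) =o[𝓝 ζ] fun z ↦ τ z - t := by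
    have h := (hasDerivAt_iff_isLittleO.1 hE).comp_tendsto hτt
    simpa [Function.comp_def, ← hζ, h0] using h
  refine Asymptotics.IsLittleO.congr' ((ho.trans_isBigO hO).mono nhdsWithin_le_nhds) ?_
    EventuallyEq.rfl
  filter_upwards [self_mem_nhdsWithin] with z hz
  congr 1
  have hz1 : ‖z / ζ‖ = 1 := by rw [norm_div, hζ1, div_one]; simpa using hz
  have h1 := norm_mul_exp_arg_mul_I (z / ζ)
  rw [hz1, ofReal_one, one_mul] at h1
  have h2 : circleMap 0 1 (τ z) = ζ * Complex.exp ((z / ζ).arg * Complex.I) := by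
    simp only [circleMap_zero, hτ, hζ, Complex.log_im, ofReal_one, one_mul, ofReal_add, add_mul,
      Complex.exp_add]
  rw [h2, h1, mul_div_cancel₀ _ hζ0]

/-- A Lipschitz function on the closed disc, analytic inside, that vanishes to first order at a
boundary point along the circle does so in the whole disc: the quotient by `z - ζ` is bounded and
is dominated by the Poisson integral of boundary values which tend to `0` at `ζ`. -/
lemma isLittleO_ball_of_isLittleO_sphere {E : ℂ → ℂ} {K : ℝ} {ζ : ℂ} (hζ : ‖ζ‖ = 1)
    (hEa : DifferentiableOn ℂ E (ball 0 1)) (hEc : Continuous E)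
    (hK : ∀ z, ‖E z‖ ≤ K * ‖z - ζ‖)
    (hE : E =o[𝓝[sphere 0 1] ζ] fun z ↦ z - ζ) :
    E =o[𝓝[ball 0 1] ζ] fun z ↦ z - ζ := by
  have hK0 : 0 ≤ K := by
    have h := (norm_nonneg _).trans (hK 0)
    simpa [hζ] using h
  set F : ℂ → ℂ := fun z ↦ E z / (z - ζ) with hF
  have hFK : ∀ z, ‖F z‖ ≤ K := fun z ↦ by
    rw [hF, norm_div]
    exact div_le_of_le_mul₀ (norm_nonneg _) hK0 (hK z)
  have hne : ∀ z ∈ ball (0 : ℂ) 1, z - ζ ≠ 0 := fun z hz h ↦ by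
    rw [sub_eq_zero.1 h] at hz
    simp [hζ] at hz
  have hFa : AnalyticInDisc F := hEa.div (by fun_prop) hne
  have hFlim : ∀ᵐ θ ∂circleMeasure,
      Tendsto (fun s : ℝ ↦ F (circleMap 0 s θ)) (𝓝[<] 1) (𝓝 (F (circleMap 0 1 θ))) := by
    have h := circleMeasure_absolutelyContinuous.ae_le
      (((countable_singleton ζ).preimage_circleMap 0 one_ne_zero).ae_notMem volume)
    filter_upwards [h] with θ hθ
    have hθ' : circleMap 0 1 θ - ζ ≠ 0 := sub_ne_zero.2 (by simpa using hθ)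
    have hc : Continuous fun s : ℝ ↦ circleMap 0 s θ := by
      unfold circleMap; fun_prop
    have : ContinuousAt (fun s : ℝ ↦ F (circleMap 0 s θ)) 1 :=
      ContinuousAt.div (by fun_prop) (by fun_prop) hθ'
    exact this.tendsto.mono_left nhdsWithin_le_nhds
  have hFP : ∀ w ∈ ball (0 : ℂ) 1,
      ‖F w‖ₑ ≤ ∫⁻ θ, ‖F (circleMap 0 1 θ)‖ₑ ∂poissonMeasure 1 w := fun w hw ↦ by
    have h := enorm_rpow_le_lintegral_boundary (p := 1) one_pos hFa (A := ENNReal.ofReal K)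
      ENNReal.ofReal_ne_top (fun r hr ↦ ?_) hFlim hw
    · simpa using h
    · refine (lintegral_mono (g := fun _ ↦ ENNReal.ofReal K) fun θ ↦ ?_).trans (by simp)
      rw [ENNReal.rpow_one, ← ofReal_norm]
      exact ENNReal.ofReal_le_ofReal (hFK _)
  rw [Asymptotics.isLittleO_iff]
  intro ε hε
  obtain ⟨η, hη, hηE⟩ := Metric.mem_nhdsWithin_iff.1 (Asymptotics.isLittleO_iff.1 hE (half_pos hε))
  have hδ : 0 < min (η / 2) (ε * η ^ 2 / (16 * (K + 1))) := by positivity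
  refine Metric.mem_nhdsWithin_iff.2 ⟨_, hδ, fun w hw ↦ ?_⟩
  obtain ⟨hwζ, hw1⟩ := hw
  rw [mem_ball, dist_eq_norm, lt_min_iff] at hwζ
  have hwn : ‖w‖ < 1 := by simpa using hw1
  have h1w : 1 - ‖w‖ ≤ ‖w - ζ‖ := by
    rw [← hζ, norm_sub_rev]; exact norm_sub_norm_le _ _
  set B : ℝ := K * (8 / η ^ 2 * ‖w - ζ‖) with hB
  have hB0 : 0 ≤ B := by positivity
  have hBε : B ≤ ε / 2 := by
    have h := (lt_div_iff₀ (by positivity)).1 hwζ.2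
    rw [hB, show K * (8 / η ^ 2 * ‖w - ζ‖) = (8 * K * ‖w - ζ‖) / η ^ 2 by ring,
      div_le_iff₀ (by positivity)]
    nlinarith [norm_nonneg (w - ζ)]
  -- near `ζ` the quotient is small; away from `ζ` the Poisson kernel is small
  have hpt : ∀ θ, ENNReal.ofReal (poissonKernel 0 w (circleMap 0 1 θ)) * ‖F (circleMap 0 1 θ)‖ₑ ≤
      ENNReal.ofReal (poissonKernel 0 w (circleMap 0 1 θ)) * ENNReal.ofReal (ε / 2)
        + ENNReal.ofReal B := fun θ ↦ by
    have hP := poissonKernel_circleMap_nonneg hw1 θ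
    rw [← ofReal_norm, ← ENNReal.ofReal_mul hP, ← ENNReal.ofReal_mul hP,
      ← ENNReal.ofReal_add (by positivity) hB0]
    refine ENNReal.ofReal_le_ofReal ?_
    have hs : circleMap 0 1 θ ∈ sphere (0 : ℂ) 1 := circleMap_mem_sphere 0 zero_le_one θ
    by_cases hθ : ‖circleMap 0 1 θ - ζ‖ < η
    · have h := hηE ⟨by rwa [mem_ball, dist_eq_norm], hs⟩
      have hF' : ‖F (circleMap 0 1 θ)‖ ≤ ε / 2 := by
        rw [hF, norm_div]
        exact div_le_of_le_mul₀ (norm_nonneg _) (by positivity) h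
      have := mul_le_mul_of_nonneg_left hF' hP
      linarith
    · have hfar : η / 2 ≤ ‖circleMap 0 1 θ - w‖ := by
        have := norm_sub_le_norm_sub_add_norm_sub (circleMap 0 1 θ) w ζ
        linarith [hwζ.1]
      have hPle : poissonKernel 0 w (circleMap 0 1 θ) ≤ 8 / η ^ 2 * ‖w - ζ‖ := by
        rw [poissonKernel_circleMap one_pos]
        calc (1 ^ 2 - ‖w‖ ^ 2) / ‖circleMap 0 1 θ - w‖ ^ 2
            ≤ (2 * ‖w - ζ‖) / (η / 2) ^ 2 := by
              gcongr
              nlinarith [norm_nonneg w]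
          _ = _ := by field_simp; ring
      have h1 := mul_le_mul hPle (hFK (circleMap 0 1 θ)) (norm_nonneg _) (by positivity)
      have h2 : 0 ≤ poissonKernel 0 w (circleMap 0 1 θ) * (ε / 2) := by positivity
      rw [hB]
      linarith
  have hle : ‖F w‖ₑ ≤ ENNReal.ofReal ε := by
    have := isProbabilityMeasure_poissonMeasure hw1
    calc ‖F w‖ₑ ≤ _ := hFP w hw1
      _ ≤ ∫⁻ θ, (ENNReal.ofReal (poissonKernel 0 w (circleMap 0 1 θ)) * ENNReal.ofReal (ε / 2)
        + ENNReal.ofReal B) ∂circleMeasure := by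
          rw [lintegral_poissonMeasure hw1]
          exact lintegral_mono hpt
      _ = ENNReal.ofReal (ε / 2) + ENNReal.ofReal B := by
          rw [lintegral_add_right _ measurable_const, ← lintegral_poissonMeasure hw1]
          simp
      _ ≤ ENNReal.ofReal ε := by
          rw [← ENNReal.ofReal_add (by positivity) hB0]
          exact ENNReal.ofReal_le_ofReal (by linarith)
  have hFε : ‖F w‖ ≤ ε := by
    rw [← ofReal_norm] at hle
    exact (ENNReal.ofReal_le_ofReal_iff hε.le).1 hle
  have hpos : 0 < ‖w - ζ‖ := norm_pos_iff.2 (hne w hw1)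
  rw [hF, norm_div, div_le_iff₀ hpos] at hFε
  exact hFε

/-- If a Lipschitz primitive `H` of `h` is differentiable along the circle at `e^{it}`, then `h` has
a radial limit there. -/
lemma exists_radial_limit_of_hasDerivAt {h H : ℂ → ℂ} {K : ℝ≥0}
    (hH : ∀ z ∈ ball (0 : ℂ) 1, HasDerivAt H (h z) z) (hL : LipschitzWith K H) {t : ℝ} {d : ℂ}
    (hd : HasDerivAt (fun θ ↦ H (circleMap 0 1 θ)) d t) :
    ∃ c, Tendsto (fun s : ℝ ↦ h (circleMap 0 s t)) (𝓝[<] 1) (𝓝 c) := by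
  set ζ := circleMap 0 1 t with hζ
  have hζ0 : ζ ≠ 0 := circleMap_ne_center one_ne_zero
  have hζ1 : ‖ζ‖ = 1 := by simp [hζ]
  -- the complex derivative along the circle: `d e^{iθ} = i ζ dθ`
  set c := d / (ζ * Complex.I) with hc
  refine ⟨c, ?_⟩
  set E : ℂ → ℂ := fun z ↦ H z - H ζ - c * (z - ζ) with hE
  have hEd : ∀ z ∈ ball (0 : ℂ) 1, HasDerivAt E (h z - c) z := fun z hz ↦ by
    have h1 := ((hH z hz).sub_const (H ζ)).sub (((hasDerivAt_id z).sub_const ζ).const_mul c)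
    rw [mul_one] at h1
    exact h1
  have hEs : HasDerivAt (fun θ ↦ E (circleMap 0 1 θ)) 0 t := by
    have h1 := (hd.sub_const (H ζ)).sub
      (((hasDerivAt_circleMap 0 1 t).sub_const ζ).const_mul c)
    have h2 : d - c * (circleMap 0 1 t * Complex.I) = 0 := by
      rw [← hζ, hc, div_mul_cancel₀ _ (mul_ne_zero hζ0 Complex.I_ne_zero), sub_self]
    rw [h2] at h1
    exact h1
  have hEK : ∀ z, ‖E z‖ ≤ (K + ‖c‖) * ‖z - ζ‖ := fun z ↦ by
    calc ‖E z‖ ≤ ‖H z - H ζ‖ + ‖c * (z - ζ)‖ := norm_sub_le _ _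
      _ ≤ K * ‖z - ζ‖ + ‖c‖ * ‖z - ζ‖ := by
          rw [norm_mul]; gcongr; exact hL.norm_sub_le z ζ
      _ = _ := by ring
  have hEc : Continuous E := by
    have := hL.continuous
    fun_prop
  have hEa : DifferentiableOn ℂ E (ball 0 1) := fun z hz ↦
    (hEd z hz).differentiableAt.differentiableWithinAt
  have ho := isLittleO_ball_of_isLittleO_sphere hζ1 hEa hEc hEK
    (isLittleO_sphere_of_hasDerivAt (by simp [hE, ← hζ]) hEs)
  rw [Metric.tendsto_nhds]
  intro ε hε
  obtain ⟨δ, hδ, hδE⟩ := Metric.mem_nhdsWithin_iff.1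
    (Asymptotics.isLittleO_iff.1 ho (show 0 < ε / 4 by positivity))
  have hev : ∀ᶠ s in 𝓝[<] (1 : ℝ), s ∈ Ioo (max 0 (1 - δ / 2)) 1 :=
    eventually_mem_Ioo (max_lt one_pos (by linarith))
  filter_upwards [hev] with s hs
  have hs0 : 0 < s := (le_max_left _ _).trans_lt hs.1
  have hsδ : 1 - δ / 2 < s := (le_max_right _ _).trans_lt hs.1
  have hs1 := hs.2
  set z := circleMap 0 s t with hz
  have hzn : ‖z‖ = s := by simp [hz, abs_of_pos hs0]
  have hzζ : ‖z - ζ‖ = 1 - s := by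
    have : z - ζ = ((s - 1 : ℝ) : ℂ) * ζ := by
      simp only [hz, hζ, circleMap_zero]; push_cast; ring
    rw [this, norm_mul, hζ1, mul_one, norm_real, Real.norm_eq_abs, abs_of_neg (by linarith)]
    ring
  have hball : ∀ u ∈ closedBall z ((1 - s) / 2), u ∈ ball (0 : ℂ) 1 := fun u hu ↦ by
    rw [mem_closedBall, dist_eq_norm] at hu
    rw [mem_ball, dist_zero_right]
    have := norm_le_norm_add_norm_sub z u
    rw [norm_sub_rev] at this
    have h2 : ‖z - u‖ = ‖u - z‖ := norm_sub_rev _ _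
    linarith
  have hR : 0 < (1 - s) / 2 := by linarith
  have hdc : DiffContOnCl ℂ E (ball z ((1 - s) / 2)) := by
    refine DifferentiableOn.diffContOnCl ?_
    rw [closure_ball _ hR.ne']
    exact hEa.mono hball
  have hsph : ∀ u ∈ sphere z ((1 - s) / 2), ‖E u‖ ≤ ε / 4 * (3 / 2 * (1 - s)) := fun u hu ↦ by
    have hu' : ‖u - ζ‖ ≤ 3 / 2 * (1 - s) := by
      have := norm_sub_le_norm_sub_add_norm_sub u z ζ
      rw [mem_sphere, dist_eq_norm] at hu
      linarith
    refine (hδE ⟨?_, hball u (sphere_subset_closedBall hu)⟩).trans (by gcongr)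
    rw [mem_ball, dist_eq_norm]
    linarith
  have hfin := Complex.norm_deriv_le_of_forall_mem_sphere_norm_le hR hdc hsph
  rw [(hEd z (hball z (mem_closedBall_self hR.le))).deriv] at hfin
  rw [dist_eq_norm]
  refine hfin.trans_lt ?_
  rw [div_lt_iff₀ hR]
  nlinarith

/-- **Fatou's theorem** for bounded analytic functions: radial limits exist almost everywhere. A
primitive is Lipschitz, so that Rademacher's theorem applies to it on the circle. -/
theorem ae_exists_radial_limit_of_bounded {h : ℂ → ℂ} (hh : AnalyticInDisc h) {M : ℝ}
    (hM : ∀ z ∈ ball (0 : ℂ) 1, ‖h z‖ ≤ M) :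
    ∀ᵐ θ : ℝ, ∃ c, Tendsto (fun s : ℝ ↦ h (circleMap 0 s θ)) (𝓝[<] 1) (𝓝 c) := by
  obtain ⟨H, hH⟩ := DifferentiableOn.isExactOn_ball hh
  have hL : LipschitzOnWith M.toNNReal H (ball 0 1) := by
    refine (convex_ball (0 : ℂ) 1).lipschitzOnWith_of_nnnorm_hasDerivWithin_le
      (fun z hz ↦ (hH z hz).hasDerivWithinAt) fun z hz ↦ ?_
    rw [← NNReal.coe_le_coe, coe_nnnorm]
    exact (hM z hz).trans (Real.le_coe_toNNReal M)
  obtain ⟨G, hG, hGH⟩ := hL.extend_finite_dimension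
  have hG' : ∀ z ∈ ball (0 : ℂ) 1, HasDerivAt G (h z) z := fun z hz ↦
    (hH z hz).congr_of_eventuallyEq
      (hGH.symm.eventuallyEq_of_mem (isOpen_ball.mem_nhds hz))
  have hlip : LipschitzWith _ fun θ ↦ G (circleMap 0 1 θ) :=
    hG.comp (lipschitzWith_circleMap 0 1)
  filter_upwards [hlip.ae_differentiableAt_real] with θ hθ
  exact exists_radial_limit_of_hasDerivAt hG' hG hθ.hasDerivAt

/-! ### Analytic majorants and boundary values of Hardy functions -/

/-- A weak form of Montel's theorem: a locally bounded sequence of analytic functions converges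
pointwise along every ultrafilter to an analytic function. -/
lemma exists_analytic_ultralimit {ι : Type*} (l : Ultrafilter ι) {F : ι → ℂ → ℂ}
    (hF : ∀ n, DifferentiableOn ℂ (F n) (ball 0 1))
    (hB : ∀ r < 1, ∃ B, ∀ n, ∀ z ∈ ball (0 : ℂ) r, ‖F n z‖ ≤ B) :
    ∃ G : ℂ → ℂ, DifferentiableOn ℂ G (ball 0 1) ∧
      ∀ z ∈ ball (0 : ℂ) 1, Tendsto (fun n ↦ F n z) l (𝓝 (G z)) := by
  have hlim : ∀ z : ℂ, ∃ c, z ∈ ball (0 : ℂ) 1 → Tendsto (fun n ↦ F n z) l (𝓝 c) := fun z ↦ by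
    by_cases hz : z ∈ ball (0 : ℂ) 1
    · have hz' : ‖z‖ < 1 := by simpa using hz
      obtain ⟨B, hB⟩ := hB ((1 + ‖z‖) / 2) (by linarith)
      have hzr : z ∈ ball (0 : ℂ) ((1 + ‖z‖) / 2) := by
        rw [mem_ball, dist_zero_right]; linarith
      obtain ⟨c, -, hc⟩ := (isCompact_closedBall (0 : ℂ) B).ultrafilter_le_nhds
        (l.map fun n ↦ F n z) (by
          rw [le_principal_iff, Ultrafilter.mem_coe, Ultrafilter.mem_map]
          refine Filter.mem_of_superset Filter.univ_mem fun n _ ↦ ?_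
          simpa using hB n z hzr)
      exact ⟨c, fun _ ↦ hc⟩
    · exact ⟨0, fun h ↦ absurd h hz⟩
  choose G hG using hlim
  refine ⟨G, ?_, hG⟩
  refine TendstoLocallyUniformlyOn.differentiableOn (F := F) (φ := (l : Filter ι)) ?_
    (Eventually.of_forall hF) isOpen_ball
  rw [Metric.tendstoLocallyUniformlyOn_iff]
  intro ε hε x hx
  have hx' : ‖x‖ < 1 := by simpa using hx
  obtain ⟨B, hB⟩ := hB ((1 + ‖x‖) / 2) (by linarith)
  set δ := (1 - ‖x‖) / 8 with hδ
  have hδ0 : 0 < δ := by linarith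
  have hsub : ∀ y ∈ ball x δ, closedBall y δ ⊆ ball (0 : ℂ) ((1 + ‖x‖) / 2) := fun y hy u hu ↦ by
    rw [mem_ball, dist_zero_right]
    rw [mem_ball, dist_eq_norm] at hy
    rw [mem_closedBall, dist_eq_norm] at hu
    have h1 := norm_le_norm_add_norm_sub x y
    have h2 := norm_le_norm_add_norm_sub y u
    rw [norm_sub_rev] at h1 h2
    have h3 : ‖x - y‖ = ‖y - x‖ := norm_sub_rev _ _
    have h4 : ‖y - u‖ = ‖u - y‖ := norm_sub_rev _ _
    linarith
  have hsub1 : ball (0 : ℂ) ((1 + ‖x‖) / 2) ⊆ ball 0 1 := ball_subset_ball (by linarith)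
  -- Cauchy's estimate makes the sequence equi-Lipschitz near `x`
  have hLip : ∀ n, ∀ y ∈ ball x δ, ‖F n y - F n x‖ ≤ B / δ * ‖y - x‖ := fun n y hy ↦ by
    refine (convex_ball x δ).norm_image_sub_le_of_norm_deriv_le (f := F n) (fun u hu ↦ ?_)
      (fun u hu ↦ ?_) (mem_ball_self hδ0) hy
    · exact (hF n).differentiableAt (isOpen_ball.mem_nhds
        (hsub1 (hsub u hu (mem_closedBall_self hδ0.le))))
    · refine Complex.norm_deriv_le_of_forall_mem_sphere_norm_le hδ0 ?_
        fun v hv ↦ hB n v (hsub u hu (sphere_subset_closedBall hv))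
      refine DifferentiableOn.diffContOnCl ?_
      rw [closure_ball _ hδ0.ne']
      exact (hF n).mono ((hsub u hu).trans hsub1)
  have hLipG : ∀ y ∈ ball x δ, ‖G y - G x‖ ≤ B / δ * ‖y - x‖ := fun y hy ↦
    le_of_tendsto ((hG y (hsub1 (hsub y hy (mem_closedBall_self hδ0.le)))).sub (hG x hx)).norm
      (Eventually.of_forall fun n ↦ hLip n y hy)
  have hK : 0 < 3 * (|B| / δ + 1) := by positivity
  refine ⟨ball x (min δ (ε / (3 * (|B| / δ + 1)))),
    mem_nhdsWithin_of_mem_nhds (ball_mem_nhds x (by positivity)), ?_⟩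
  filter_upwards [Metric.tendsto_nhds.1 (hG x hx) (ε / 3) (by positivity)] with n hn y hy
  rw [mem_ball, lt_min_iff] at hy
  rw [dist_eq_norm] at hn
  have h1 := hLip n y hy.1
  have h2 := hLipG y hy.1
  have h3 : B / δ * ‖y - x‖ < ε / 3 := by
    have h4 := (lt_div_iff₀ hK).1 hy.2
    rw [dist_eq_norm] at h4
    have h5 : B / δ * ‖y - x‖ ≤ |B| / δ * ‖y - x‖ := by
      gcongr; exact le_abs_self B
    nlinarith [norm_nonneg (y - x)]
  rw [dist_eq_norm]
  have h6 : G y - F n y = (G y - G x) - (F n y - F n x) - (F n x - G x) := by ring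
  rw [h6]
  have h7 := norm_sub_le ((G y - G x) - (F n y - F n x)) (F n x - G x)
  have h8 := norm_sub_le (G y - G x) (F n y - F n x)
  linarith

lemma circleMap_zero_smul (ρ r θ : ℝ) : (ρ : ℂ) * circleMap 0 r θ = circleMap 0 (ρ * r) θ := by
  simp only [circleMap_zero]; push_cast; ring

lemma enorm_rpow_eq_ofReal (z : ℂ) {p : ℝ} (hp : 0 ≤ p) :
    ‖z‖ₑ ^ p = ENNReal.ofReal (‖z‖ ^ p) := by
  rw [← ofReal_norm, ENNReal.ofReal_rpow_of_nonneg (norm_nonneg z) hp]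

/-- For `f` in `H^p`, the subharmonic function `|f|^p` is dominated by the real part of an analytic
function, a limit of Herglotz integrals of `|f|^p` over circles inside the disc. -/
theorem exists_analytic_majorant {f : ℂ → ℂ} {p : ℝ} (hp : 0 < p) (hf : AnalyticInDisc f)
    {A : ℝ≥0∞} (hA : A ≠ ∞)
    (hbd : ∀ r ∈ Ico (0 : ℝ) 1, ∫⁻ θ, ‖f (circleMap 0 r θ)‖ₑ ^ p ∂circleMeasure ≤ A) :
    ∃ S : ℂ → ℂ, AnalyticInDisc S ∧ ∀ z ∈ ball (0 : ℂ) 1, ‖f z‖ ^ p ≤ (S z).re := by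
  set ρ : ℕ → ℝ := fun n ↦ 1 - 1 / ((n : ℝ) + 1) with hρ
  have hρm : ∀ n, ρ n ∈ Ico (0 : ℝ) 1 := one_sub_inv_mem_Ico
  -- the dilated functions `f (ρ n z)` are analytic on the closed disc, so that the Herglotz
  -- integrals `T n` over the unit circle are all defined in the whole disc
  set g : ℕ → ℂ → ℝ := fun n z ↦ ‖f (ρ n * z)‖ ^ p with hg
  have hmaps : ∀ n, MapsTo (fun z : ℂ ↦ (ρ n : ℂ) * z) (closedBall 0 1) (ball 0 1) :=
    fun n z hz ↦ by
      simp only [mem_ball, mem_closedBall, dist_zero_right, norm_mul, norm_real,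
        Real.norm_eq_abs, abs_of_nonneg (hρm n).1] at hz ⊢
      nlinarith [(hρm n).1, (hρm n).2, norm_nonneg z]
  have hfa : ∀ n, AnalyticOnNhd ℂ (fun z ↦ f (ρ n * z)) (closedBall 0 1) := fun n ↦
    (hf.analyticOnNhd isOpen_ball).comp (fun z _ ↦ by fun_prop) (hmaps n)
  have hgc : ∀ n, CircleIntegrable (g n) 0 1 := fun n ↦
    ContinuousOn.circleIntegrable zero_le_one
      (((hfa n).continuousOn.mono sphere_subset_closedBall).norm.rpow_const
        fun _ _ ↦ Or.inr hp.le)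
  have hg0 : ∀ n z, 0 ≤ g n z := fun n z ↦ by positivity
  have hgA : ∀ n, ∫ θ, g n (circleMap 0 1 θ) ∂circleMeasure ≤ A.toReal := fun n ↦ by
    rw [integral_eq_lintegral_of_nonneg_ae (ae_of_all _ fun θ ↦ hg0 n _)
      (circleIntegrable_iff_integrable.1 (hgc n)).aestronglyMeasurable]
    refine ENNReal.toReal_mono hA ((lintegral_congr fun θ ↦ ?_).trans_le (hbd (ρ n) (hρm n)))
    simp only [hg]
    rw [enorm_rpow_eq_ofReal _ hp.le, circleMap_zero_smul, mul_one]
  set T : ℕ → ℂ → ℂ := fun n w ↦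
    circleAverage (fun ζ ↦ herglotzRieszKernel 0 w ζ • ((g n ζ : ℝ) : ℂ)) 0 1 with hT
  have hgcC : ∀ n, CircleIntegrable (fun ζ ↦ ((g n ζ : ℝ) : ℂ)) 0 1 := fun n ↦ by
    rw [circleIntegrable_iff_integrable]
    exact (circleIntegrable_iff_integrable.1 (hgc n)).ofReal
  have hTd : ∀ n, DifferentiableOn ℂ (T n) (ball 0 1) := fun n ↦
    differentiableOn_circleAverage_herglotzRieszKernel_smul (hgcC n)
  have hTb : ∀ r < (1 : ℝ), ∃ B, ∀ n, ∀ z ∈ ball (0 : ℂ) r, ‖T n z‖ ≤ B := fun r hr ↦ by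
    refine ⟨2 / (1 - r) * A.toReal, fun n z hz ↦ ?_⟩
    rw [mem_ball, dist_zero_right] at hz
    calc ‖T n z‖ ≤ ∫ θ, 2 / (1 - r) * g n (circleMap 0 1 θ) ∂circleMeasure := by
          simp only [hT, circleAverage_eq_integral]
          refine norm_integral_le_of_norm_le
            ((circleIntegrable_iff_integrable.1 (hgc n)).const_mul _) (ae_of_all _ fun θ ↦ ?_)
          rw [norm_smul, norm_real, Real.norm_eq_abs, abs_of_nonneg (hg0 n _)]
          refine mul_le_mul_of_nonneg_right ?_ (hg0 n _)
          rw [herglotzRieszKernel_def, norm_div]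
          have h1 : ‖circleMap 0 1 θ‖ = 1 := by simp
          have h2 := norm_add_le (circleMap 0 1 θ) z
          have h3 := norm_sub_norm_le (circleMap 0 1 θ) z
          rw [h1] at h2 h3
          simp only [sub_zero]
          gcongr <;> linarith
      _ ≤ 2 / (1 - r) * A.toReal := by
          rw [integral_const_mul]
          have : 0 ≤ 2 / (1 - r) := div_nonneg zero_le_two (by linarith)
          exact mul_le_mul_of_nonneg_left (hgA n) this
  have hTre : ∀ n, ∀ z ∈ ball (0 : ℂ) 1, ‖f (ρ n * z)‖ ^ p ≤ (T n z).re := fun n z hz ↦ by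
    rw [hT, re_circleAverage_herglotzRieszKernel_smul (hgc n) hz,
      ← poissonKernel_eq_re_herglotzRieszKernel, ← integral_poissonMeasure hz]
    have h := enorm_rpow_le_lintegral_poissonMeasure hp (hfa n) hz
    simp_rw [enorm_rpow_eq_ofReal _ hp.le] at h
    rw [← ofReal_integral_eq_lintegral_ofReal (integrable_poissonMeasure hz (hgc n))
      (ae_of_all _ fun θ ↦ hg0 n _)] at h
    exact (ENNReal.ofReal_le_ofReal_iff (integral_nonneg fun θ ↦ hg0 n _)).1 h
  obtain ⟨S, hS, hTS⟩ := exists_analytic_ultralimit (hyperfilter ℕ) hTd hTb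
  refine ⟨S, hS, fun z hz ↦ ?_⟩
  have h1 : Tendsto (fun n ↦ ‖f (ρ n * z)‖ ^ p) (hyperfilter ℕ) (𝓝 (‖f z‖ ^ p)) := by
    have h2 : Tendsto (fun n ↦ (ρ n : ℂ) * z) atTop (𝓝 z) := by
      have h3 := ((Complex.continuous_ofReal.tendsto 1).comp
        (tendsto_one_sub_inv.mono_right nhdsWithin_le_nhds)).mul_const z
      simpa [hρ, Function.comp_def] using h3
    have h4 := ((hf.differentiableAt (isOpen_ball.mem_nhds hz)).continuousAt.tendsto.comp h2).norm
    exact (h4.rpow_const (Or.inr hp.le)).mono_left Nat.hyperfilter_le_atTop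
  exact le_of_tendsto_of_tendsto h1 ((Complex.continuous_re.tendsto _).comp (hTS z hz))
    (Eventually.of_forall fun n ↦ hTre n z hz)

/-- If `Re S ≥ 0`, the radial limits of `exp (-S)` are almost everywhere nonzero: the circle means
of `Re S` all equal `Re S 0`, so `Re S` has a finite lower limit along almost every radius. -/
lemma ae_radial_limit_exp_neg_ne_zero {S : ℂ → ℂ} (hS : AnalyticInDisc S)
    (hre : ∀ z ∈ ball (0 : ℂ) 1, 0 ≤ (S z).re) :
    ∀ᵐ θ ∂circleMeasure, ¬ Tendsto (fun s : ℝ ↦ Complex.exp (-S (circleMap 0 s θ))) (𝓝[<] 1)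
      (𝓝 0) := by
  set ρ : ℕ → ℝ := fun n ↦ 1 - 1 / ((n : ℝ) + 1) with hρ
  have hρm : ∀ n, ρ n ∈ Ico (0 : ℝ) 1 := one_sub_inv_mem_Ico
  set u : ℕ → ℝ → ℝ≥0∞ := fun n θ ↦ ENNReal.ofReal (S (circleMap 0 (ρ n) θ)).re with hu
  have hc : ∀ n, Continuous fun θ ↦ (S (circleMap 0 (ρ n) θ)).re := fun n ↦
    Complex.continuous_re.comp (continuous_comp_circleMap hS (hρm n))
  have hum : ∀ n, Measurable (u n) := fun n ↦ (hc n).measurable.ennreal_ofReal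
  have hmean : ∀ n, ∫⁻ θ, u n θ ∂circleMeasure = ENNReal.ofReal (S 0).re := fun n ↦ by
    rw [← ofReal_integral_eq_lintegral_ofReal (integrable_of_continuous (hc n))
      (ae_of_all _ fun θ ↦ hre _ (circleMap_mem_ball (hρm n) θ))]
    congr 1
    have h1 : circleAverage S 0 (ρ n) = S 0 := by
      refine DiffContOnCl.circleAverage (DifferentiableOn.diffContOnCl (hS.mono ?_))
      refine closure_ball_subset_closedBall.trans (closedBall_subset_ball ?_)
      rw [abs_of_nonneg (hρm n).1]; exact (hρm n).2
    rw [← h1, circleAverage_eq_integral]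
    have h2 : Integrable (fun θ ↦ S (circleMap 0 (ρ n) θ)) circleMeasure :=
      integrable_of_continuous (continuous_comp_circleMap hS (hρm n))
    exact (integral_re h2)
  have hfin : ∫⁻ θ, liminf (fun n ↦ u n θ) atTop ∂circleMeasure ≠ ∞ := by
    refine ne_top_of_le_ne_top (ENNReal.ofReal_ne_top (r := (S 0).re))
      ((lintegral_liminf_le hum).trans ?_)
    simp [hmean]
  filter_upwards [ae_lt_top (Measurable.liminf hum) hfin] with θ hθ h0
  have h1 : Tendsto (fun n ↦ Real.exp (-(S (circleMap 0 (ρ n) θ)).re)) atTop (𝓝 0) := by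
    have h2 := (h0.comp tendsto_one_sub_inv).norm
    simpa [hρ, Function.comp_def, Complex.norm_exp] using h2
  have h3 : Tendsto (fun n ↦ (S (circleMap 0 (ρ n) θ)).re) atTop atTop := by
    exact tendsto_neg_atBot_iff.1 (Real.tendsto_exp_comp_nhds_zero.1 h1)
  have h4 : Tendsto (fun n ↦ u n θ) atTop (𝓝 ∞) := ENNReal.tendsto_ofReal_atTop.comp h3
  rw [h4.liminf_eq] at hθ
  exact lt_irrefl _ hθ

lemma exists_mul_exp_neg_rpow_le {p : ℝ} (hp : 0 < p) :
    ∃ C : ℝ, ∀ x : ℝ, 0 ≤ x → x * Real.exp (-x ^ p) ≤ C := by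
  obtain ⟨n, hn⟩ := exists_nat_ge (1 / p)
  refine ⟨n.factorial * Real.exp 1, fun x hx ↦ ?_⟩
  have hy : 0 ≤ x ^ p := by positivity
  have h1 : x ≤ (1 + x ^ p) ^ n := by
    calc x = (x ^ p) ^ (1 / p) := by rw [← Real.rpow_mul hx, mul_one_div_cancel hp.ne', Real.rpow_one]
      _ ≤ (1 + x ^ p) ^ (1 / p) := Real.rpow_le_rpow hy (by linarith) (by positivity)
      _ ≤ (1 + x ^ p) ^ (n : ℝ) := Real.rpow_le_rpow_of_exponent_le (by linarith) hn
      _ = _ := Real.rpow_natCast _ _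
  have h2 := Real.pow_div_factorial_le_exp (1 + x ^ p) (by linarith) n
  rw [div_le_iff₀ (by positivity)] at h2
  calc x * Real.exp (-x ^ p) ≤ (Real.exp (1 + x ^ p) * n.factorial) * Real.exp (-x ^ p) := by
        gcongr; exact h1.trans h2
    _ = n.factorial * Real.exp 1 := by
        rw [mul_right_comm, ← Real.exp_add]; ring_nf

/-- **Fatou's theorem** for Hardy spaces: functions in `H^p`, `0 < p < ∞`, have finite radial limits
almost everywhere. If `S` is an analytic majorant, then `f = (f exp (-S)) / exp (-S)` is a quotient
of bounded analytic functions. -/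
theorem ae_exists_radial_limit {f : ℂ → ℂ} {p : ℝ} (hp : 0 < p) (hf : AnalyticInDisc f)
    {A : ℝ≥0∞} (hA : A ≠ ∞)
    (hbd : ∀ r ∈ Ico (0 : ℝ) 1, ∫⁻ θ, ‖f (circleMap 0 r θ)‖ₑ ^ p ∂circleMeasure ≤ A) :
    ∀ᵐ θ ∂circleMeasure, ∃ c, Tendsto (fun s : ℝ ↦ f (circleMap 0 s θ)) (𝓝[<] 1) (𝓝 c) := by
  obtain ⟨S, hS, hfS⟩ := exists_analytic_majorant hp hf hA hbd
  have hre : ∀ z ∈ ball (0 : ℂ) 1, 0 ≤ (S z).re := fun z hz ↦ le_trans (by positivity) (hfS z hz)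
  have hexp : AnalyticInDisc fun z ↦ Complex.exp (-S z) := hS.neg.cexp
  obtain ⟨C, hC⟩ := exists_mul_exp_neg_rpow_le hp
  have h1 := circleMeasure_absolutelyContinuous.ae_le
    (ae_exists_radial_limit_of_bounded hexp (M := 1) fun z hz ↦ by
      rw [Complex.norm_exp, Real.exp_le_one_iff]; simpa using hre z hz)
  have h2 := circleMeasure_absolutelyContinuous.ae_le
    (ae_exists_radial_limit_of_bounded (hf.mul hexp) (M := C) fun z hz ↦ by
      simp only [Pi.mul_apply]
      rw [norm_mul, Complex.norm_exp]
      refine le_trans ?_ (hC ‖f z‖ (norm_nonneg _))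
      gcongr
      simpa using hfS z hz)
  filter_upwards [h1, h2, ae_radial_limit_exp_neg_ne_zero hS hre] with θ ⟨a, ha⟩ ⟨b, hb⟩ h0
  refine ⟨b / a, ?_⟩
  have ha0 : a ≠ 0 := by rintro rfl; exact h0 ha
  refine (hb.div ha ha0).congr fun s ↦ ?_
  simp only [Pi.mul_apply, Pi.div_apply]
  rw [mul_div_cancel_right₀ _ (Complex.exp_ne_zero _)]

/-! ### Boundary values in terms of the amalgam definitions -/

lemma integralMean_eq {p : ℝ≥0∞} (hp : p ≠ ∞) (r : ℝ) (f : ℂ → ℂ) :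
    integralMean p r f =
      (∫⁻ θ, ‖f (circleMap 0 r θ)‖ₑ ^ p.toReal ∂circleMeasure) ^ (1 / p.toReal) := by
  rw [integralMean, if_neg hp]; rfl

lemma lintegral_le_hardyNorm_rpow {p : ℝ≥0∞} (hp0 : 0 < p) (hp : p ≠ ∞) (f : ℂ → ℂ) {r : ℝ}
    (hr : r ∈ Ico (0 : ℝ) 1) :
    ∫⁻ θ, ‖f (circleMap 0 r θ)‖ₑ ^ p.toReal ∂circleMeasure ≤ hardyNorm p f ^ p.toReal := by
  have hp' : 0 < p.toReal := ENNReal.toReal_pos hp0.ne' hp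
  have h : integralMean p r f ≤ hardyNorm p f :=
    le_iSup₂ (f := fun r (_ : r ∈ Ico (0 : ℝ) 1) ↦ integralMean p r f) r hr
  rwa [integralMean_eq hp, one_div, ENNReal.rpow_inv_le_iff hp'] at h

lemma hardyNorm_rpow_ne_top {p : ℝ≥0∞} {f : ℂ → ℂ} (hf : MemHardy p f) :
    hardyNorm p f ^ p.toReal ≠ ∞ :=
  ENNReal.rpow_ne_top_of_nonneg ENNReal.toReal_nonneg hf.2.ne

lemma ae_tendsto_polarValue {p : ℝ≥0∞} (hp0 : 0 < p) (hp : p ≠ ∞) {f : ℂ → ℂ} (hf : MemHardy p f) :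
    ∀ᵐ θ ∂circleMeasure,
      Tendsto (fun s : ℝ ↦ f (circleMap 0 s θ)) (𝓝[<] 1) (𝓝 (polarValue f 1 θ)) := by
  filter_upwards [ae_exists_radial_limit (ENNReal.toReal_pos hp0.ne' hp) hf.1
    (hardyNorm_rpow_ne_top hf) fun r hr ↦ lintegral_le_hardyNorm_rpow hp0 hp f hr] with θ ⟨c, hc⟩
  rw [polarValue, if_pos rfl, hc.limUnder_eq]
  exact hc

lemma hasBoundaryValues {p : ℝ≥0∞} (hp0 : 0 < p) (hp : p ≠ ∞) {f : ℂ → ℂ} (hf : MemHardy p f) :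
    HasBoundaryValues f :=
  ae_circleMeasure_iff.1 ((ae_tendsto_polarValue hp0 hp hf).mono fun _ h ↦ ⟨_, h⟩)

/-- By Fatou's lemma, the `L^p` norm of the boundary values is at most the `H^p` norm. -/
lemma lintegral_polarValue_le {p : ℝ≥0∞} (hp0 : 0 < p) (hp : p ≠ ∞) {f : ℂ → ℂ}
    (hf : MemHardy p f) :
    ∫⁻ θ, ‖polarValue f 1 θ‖ₑ ^ p.toReal ∂circleMeasure ≤ hardyNorm p f ^ p.toReal := by
  set ρ : ℕ → ℝ := fun n ↦ 1 - 1 / ((n : ℝ) + 1)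
  have hρ : ∀ n, ρ n ∈ Ico (0 : ℝ) 1 := one_sub_inv_mem_Ico
  have h1 : ∀ᵐ θ ∂circleMeasure, ‖polarValue f 1 θ‖ₑ ^ p.toReal
      = liminf (fun n ↦ ‖f (circleMap 0 (ρ n) θ)‖ₑ ^ p.toReal) atTop := by
    filter_upwards [ae_tendsto_polarValue hp0 hp hf] with θ hθ
    exact (((ENNReal.continuous_rpow_const.tendsto _).comp
      (hθ.comp tendsto_one_sub_inv).enorm).liminf_eq).symm
  rw [lintegral_congr_ae h1]
  refine (lintegral_liminf_le fun n ↦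
    ((continuous_comp_circleMap hf.1 (hρ n)).enorm.measurable).pow_const _).trans ?_
  refine (liminf_le_liminf (Eventually.of_forall fun n ↦
    lintegral_le_hardyNorm_rpow hp0 hp f (hρ n))).trans ?_
  simp

/-! ### Arcs and sequence norms -/

lemma measurableSet_arc (N l : ℕ) : MeasurableSet (arc N l) := measurableSet_Icc

lemma arc_subset {N l : ℕ} (hl : l < N) : arc N l ⊆ Icc 0 (2 * π) := by
  have hN : (0 : ℝ) < N := by exact_mod_cast (Nat.zero_le l).trans_lt hl
  have hl' : (l : ℝ) + 1 ≤ N := by exact_mod_cast hl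
  refine Icc_subset_Icc (by positivity) ?_
  have : ((l : ℝ) + 1) / N ≤ 1 := by rwa [div_le_one hN]
  nlinarith [Real.two_pi_pos]

lemma circleMeasure_restrict_arc {N l : ℕ} (hl : l < N) :
    circleMeasure.restrict (arc N l) = angleMeasure.restrict (arc N l) := by
  rw [circleMeasure, Measure.restrict_restrict (measurableSet_arc N l),
    inter_eq_left.2 (arc_subset hl)]

lemma circleMeasure_arc {N l : ℕ} (hl : l < N) : circleMeasure (arc N l) = (N : ℝ≥0∞)⁻¹ := by
  have hN : (0 : ℝ) < N := by exact_mod_cast (Nat.zero_le l).trans_lt hl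
  rw [← Measure.restrict_apply_univ, circleMeasure_restrict_arc hl, Measure.restrict_apply_univ,
    angleMeasure, Measure.smul_apply, arc, Real.volume_Icc, smul_eq_mul]
  have : 2 * π * (((l : ℝ) + 1) / N) - 2 * π * ((l : ℝ) / N) = 2 * π * (N : ℝ)⁻¹ := by
    field_simp; ring
  rw [this, ENNReal.ofReal_mul Real.two_pi_pos.le, ← mul_assoc,
    ENNReal.inv_mul_cancel ofReal_two_pi_ne_zero ENNReal.ofReal_ne_top, one_mul,
    ENNReal.ofReal_inv_of_pos hN, ENNReal.ofReal_natCast]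

lemma iUnion_arc {N : ℕ} (hN : 0 < N) : ⋃ l : Fin N, arc N l = Icc 0 (2 * π) := by
  have hN' : (0 : ℝ) < N := by exact_mod_cast hN
  refine Subset.antisymm (iUnion_subset fun l ↦ arc_subset l.2) fun θ hθ ↦ ?_
  rw [mem_iUnion]
  have hpi := Real.two_pi_pos
  rcases hθ.2.eq_or_lt with h | h
  · refine ⟨⟨N - 1, by omega⟩, ?_, ?_⟩
    · rw [h]
      have : (((N - 1 : ℕ) : ℝ)) / N ≤ 1 := by
        rw [div_le_one hN']; exact_mod_cast Nat.sub_le N 1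
      nlinarith
    · rw [h, Nat.cast_sub (Nat.succ_le_of_lt hN)]
      simp [hN'.ne']
  · have hx0 : 0 ≤ θ * N / (2 * π) := by have := hθ.1; positivity
    have h1 := Nat.floor_le hx0
    have h2 := Nat.lt_floor_add_one (θ * N / (2 * π))
    rw [le_div_iff₀ hpi] at h1
    rw [div_lt_iff₀ hpi] at h2
    refine ⟨⟨⌊θ * N / (2 * π)⌋₊, ?_⟩, ?_, ?_⟩
    · rw [Nat.floor_lt hx0, div_lt_iff₀ hpi]
      nlinarith
    · rw [mul_div_assoc', div_le_iff₀ hN']; linarith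
    · rw [mul_div_assoc', le_div_iff₀ hN']; linarith

lemma aedisjoint_arc (N : ℕ) :
    Pairwise (Function.onFun (AEDisjoint circleMeasure) fun l : Fin N ↦ arc N l) := by
  have key : ∀ l l' : Fin N, l < l' → AEDisjoint circleMeasure (arc N l) (arc N l') :=
    fun l l' h ↦ by
      have hN : (0 : ℝ) < N := by exact_mod_cast (Nat.zero_le _).trans_lt l.2
      have hle : ((l : ℕ) : ℝ) + 1 ≤ ((l' : ℕ) : ℝ) := by exact_mod_cast h
      refine circleMeasure_absolutelyContinuous (measure_mono_null (fun θ hθ ↦ ?_)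
        (Real.volume_singleton (a := 2 * π * ((((l : ℕ) : ℝ) + 1) / N))))
      obtain ⟨⟨-, h1⟩, h2, -⟩ := hθ
      refine le_antisymm h1 (le_trans ?_ h2)
      have := Real.two_pi_pos
      gcongr
  intro l l' h
  rcases lt_or_gt_of_ne h with h | h
  · exact key l l' h
  · exact (key l' l h).symm

lemma sum_lintegral_arc {N : ℕ} (hN : 0 < N) (F : ℝ → ℝ≥0∞) :
    ∑ l : Fin N, ∫⁻ θ in arc N l, F θ ∂circleMeasure = ∫⁻ θ, F θ ∂circleMeasure := by
  rw [← tsum_fintype (L := .unconditional _), ← lintegral_iUnion₀ (s := fun l : Fin N ↦ arc N l)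
    (fun l ↦ (measurableSet_arc N l).nullMeasurableSet) (aedisjoint_arc N), iUnion_arc hN,
    circleMeasure, Measure.restrict_restrict measurableSet_Icc, inter_self]

lemma localNorm_rpow {p : ℝ≥0∞} (hp0 : 0 < p) (hp : p ≠ ∞) (f : ℂ → ℂ) (ρ : ℝ) {N l : ℕ}
    (hl : l < N) :
    localNorm p f ρ N l ^ p.toReal
      = ∫⁻ θ in arc N l, ‖polarValue f ρ θ‖ₑ ^ p.toReal ∂circleMeasure := by
  rw [localNorm, ← ENNReal.rpow_mul, one_div_mul_cancel (ENNReal.toReal_pos hp0.ne' hp).ne',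
    ENNReal.rpow_one, circleMeasure_restrict_arc hl]

lemma sum_rpow_le_rpow_sum {ι : Type*} (t : Finset ι) (a : ι → ℝ≥0∞) {s : ℝ} (hs : 1 ≤ s) :
    ∑ i ∈ t, a i ^ s ≤ (∑ i ∈ t, a i) ^ s := by
  classical
  induction t using Finset.induction_on with
  | empty => simp
  | insert i t hi ih =>
    rw [Finset.sum_insert hi, Finset.sum_insert hi]
    exact (add_le_add_right ih _).trans (ENNReal.add_rpow_le_rpow_add _ _ hs)

/-- The embedding `ℓ^p ⊆ ℓ^q` for `p < q`. -/
lemma lqNorm_le_of_lt {p q : ℝ≥0∞} (hp0 : 0 < p) (hpq : p < q) {N : ℕ} (a : Fin N → ℝ≥0∞) :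
    lqNorm q a ≤ (∑ l, a l ^ p.toReal) ^ (1 / p.toReal) := by
  have hp' : 0 < p.toReal := ENNReal.toReal_pos hp0.ne' hpq.ne_top
  rw [lqNorm, one_div, one_div]
  split_ifs with hq
  · refine iSup_le fun l ↦ ?_
    rw [ENNReal.le_rpow_inv_iff hp']
    exact Finset.single_le_sum (f := fun l ↦ a l ^ p.toReal) (fun _ _ ↦ zero_le) (Finset.mem_univ l)
  · have hpq' : p.toReal < q.toReal := (ENNReal.toReal_lt_toReal hpq.ne_top hq).2 hpq
    have hq' : 0 < q.toReal := hp'.trans hpq'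
    rw [ENNReal.rpow_inv_le_iff hq', ← ENNReal.rpow_mul, mul_comm, ← div_eq_mul_inv]
    refine le_trans (le_of_eq ?_) (sum_rpow_le_rpow_sum _ _ ((one_le_div hp').2 hpq'.le))
    refine Finset.sum_congr rfl fun l _ ↦ ?_
    rw [← ENNReal.rpow_mul, mul_div_cancel₀ _ hp'.ne']

lemma lqNorm_const {q : ℝ≥0∞} (hq : 0 < q) {N : ℕ} (hN : 0 < N) (c : ℝ≥0∞) :
    lqNorm q (fun _ : Fin N ↦ c) = (N : ℝ≥0∞) ^ (1 / q.toReal) * c := by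
  have : Nonempty (Fin N) := ⟨⟨0, hN⟩⟩
  rw [lqNorm]
  split_ifs with h
  · simp [h]
  · have hq' : 0 < q.toReal := ENNReal.toReal_pos hq.ne' h
    rw [Finset.sum_const, Finset.card_univ, Fintype.card_fin, nsmul_eq_mul,
      ENNReal.mul_rpow_of_nonneg _ _ (by positivity), ← ENNReal.rpow_mul,
      mul_one_div_cancel hq'.ne', ENNReal.rpow_one]

/-! ### The amalgam norm of the boundary values and the Hardy norm -/

theorem amalgamNorm_le_hardyNorm {p q : ℝ≥0∞} (hp0 : 0 < p) (hpq : p < q) {N : ℕ} (hN : 0 < N)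
    {f : ℂ → ℂ} (hf : MemHardy p f) : amalgamNorm p q f 1 N ≤ hardyNorm p f := by
  have hp : p ≠ ∞ := hpq.ne_top
  have hp' : 0 < p.toReal := ENNReal.toReal_pos hp0.ne' hp
  rw [amalgamNorm, if_neg (fun h ↦ h.2 (hasBoundaryValues hp0 hp hf))]
  refine (lqNorm_le_of_lt hp0 hpq _).trans ?_
  rw [one_div, ENNReal.rpow_inv_le_iff hp',
    Finset.sum_congr rfl fun l _ ↦ localNorm_rpow hp0 hp f 1 l.2, sum_lintegral_arc hN]
  exact lintegral_polarValue_le hp0 hp hf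

lemma one_div_toReal_sub_pos {p q : ℝ≥0∞} (hp0 : 0 < p) (hpq : p < q) :
    0 < 1 / p.toReal - 1 / q.toReal := by
  have hp' : 0 < p.toReal := ENNReal.toReal_pos hp0.ne' hpq.ne_top
  by_cases hq : q = ∞
  · simp [hq, hp']
  · rw [sub_pos]
    exact one_div_lt_one_div_of_lt hp' ((ENNReal.toReal_lt_toReal hpq.ne_top hq).2 hpq)

lemma hardyNorm_one {p : ℝ≥0∞} (hp : p ≠ ∞) : hardyNorm p (fun _ ↦ 1) = 1 := by
  have h : ∀ r : ℝ, integralMean p r (fun _ ↦ 1) = 1 := fun r ↦ by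
    rw [integralMean_eq hp]; simp
  simp only [hardyNorm, h]
  exact biSup_const ⟨0, by simp⟩

lemma amalgamNorm_one {p q : ℝ≥0∞} (hp0 : 0 < p) (hpq : p < q) {N : ℕ} (hN : 0 < N) :
    amalgamNorm p q (fun _ ↦ 1) 1 N
      = (N : ℝ≥0∞) ^ (-(1 / p.toReal - 1 / q.toReal)) := by
  have hN0 : (N : ℝ≥0∞) ≠ 0 := by exact_mod_cast hN.ne'
  have hpol : ∀ θ, polarValue (fun _ ↦ 1) 1 θ = 1 := fun θ ↦ by
    rw [polarValue, if_pos rfl]; exact tendsto_const_nhds.limUnder_eq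
  have hloc : ∀ l : Fin N, localNorm p (fun _ ↦ 1) 1 N l
      = (N : ℝ≥0∞) ^ (-(1 / p.toReal)) := fun l ↦ by
    rw [localNorm, ← circleMeasure_restrict_arc l.2]
    simp only [hpol, enorm_one, ENNReal.one_rpow, lintegral_one, Measure.restrict_apply_univ,
      circleMeasure_arc l.2]
    rw [ENNReal.inv_rpow, ENNReal.rpow_neg]
  have hbv : HasBoundaryValues fun _ ↦ 1 := ae_of_all _ fun θ ↦ ⟨1, tendsto_const_nhds⟩
  rw [amalgamNorm, if_neg (fun h ↦ h.2 hbv)]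
  simp only [hloc]
  rw [lqNorm_const (hp0.trans hpq) hN, ← ENNReal.rpow_add _ _ hN0 (ENNReal.natCast_ne_top N)]
  congr 1
  ring

/-- For the constant function `1` the ratio of the Hardy norm to the amalgam norm over `N` arcs is
`N^(1/p - 1/q)`, which is unbounded. -/
theorem exists_lt_hardyNorm_div_amalgamNorm {p q : ℝ≥0∞} (hp0 : 0 < p) (hpq : p < q) (K : ℝ≥0) :
    ∃ f : ℂ → ℂ, ∃ N : ℕ, MemHardy p f ∧ 0 < N ∧ amalgamNorm p q f 1 N ≠ 0 ∧
      (K : ℝ≥0∞) < hardyNorm p f / amalgamNorm p q f 1 N := by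
  have hα := one_div_toReal_sub_pos hp0 hpq
  have ht : Tendsto (fun N : ℕ ↦ (N : ℝ≥0∞) ^ (1 / p.toReal - 1 / q.toReal)) atTop (𝓝 ∞) := by
    have h := (ENNReal.continuous_rpow_const (y := 1 / p.toReal - 1 / q.toReal)).tendsto ∞
    rw [ENNReal.top_rpow_of_pos hα] at h
    exact h.comp ENNReal.tendsto_nat_nhds_top
  obtain ⟨N, hK, hN⟩ := ((ht.eventually (lt_mem_nhds ENNReal.coe_lt_top)).and
    (eventually_gt_atTop 0)).exists
  refine ⟨fun _ ↦ 1, N, ⟨differentiableOn_const 1, ?_⟩, hN, ?_, ?_⟩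
  · rw [hardyNorm_one hpq.ne_top]; exact ENNReal.one_lt_top
  · rw [amalgamNorm_one hp0 hpq hN]
    exact (ENNReal.rpow_pos (by exact_mod_cast hN) (ENNReal.natCast_ne_top N)).ne'
  · rw [amalgamNorm_one hp0 hpq hN, hardyNorm_one hpq.ne_top, ENNReal.rpow_neg, one_div, inv_inv]
    exact hK

/-! ### Integral means and amalgam norms on larger circles -/

/-- For `r < ρ ≤ 1`, the power `|f|^p` is dominated on the circle of radius `r` by the Poisson
integral of its values (or boundary values) on the circle of radius `ρ`. -/
lemma enorm_rpow_le_lintegral_polarValue {p : ℝ≥0∞} (hp0 : 0 < p) (hp : p ≠ ∞) {f : ℂ → ℂ}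
    (hf : AnalyticInDisc f) {ρ : ℝ} (hρ : ρ ≤ 1) (hρ1 : ρ = 1 → MemHardy p f) {w : ℂ}
    (hw : w ∈ ball (0 : ℂ) ρ) :
    ‖f w‖ₑ ^ p.toReal ≤ ∫⁻ θ, ‖polarValue f ρ θ‖ₑ ^ p.toReal ∂poissonMeasure ρ w := by
  have hp' : 0 < p.toReal := ENNReal.toReal_pos hp0.ne' hp
  rcases hρ.eq_or_lt with rfl | h
  · have hfp := hρ1 rfl
    exact enorm_rpow_le_lintegral_boundary hp' hf (hardyNorm_rpow_ne_top hfp)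
      (fun r hr ↦ lintegral_le_hardyNorm_rpow hp0 hp f hr) (ae_tendsto_polarValue hp0 hp hfp) hw
  · simp only [polarValue, if_neg h.ne]
    exact enorm_rpow_le_lintegral_poissonMeasure hp' (analyticOnNhd_closedBall hf h) hw

/-- **Harnack's inequality** for the Poisson kernel: on arcs of length comparable to the distance of
the pole to the circle, the Poisson kernel is constant up to a bounded factor. -/
lemma poissonKernel_le_of_abs_sub_le {ρ c : ℝ} (hρ : ρ ≤ 1) (hc : 0 ≤ c) {w : ℂ}
    (hw : w ∈ ball (0 : ℂ) ρ) {θ θ' : ℝ} (hθ : |θ' - θ| ≤ c * (ρ - ‖w‖)) :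
    poissonKernel 0 w (circleMap 0 ρ θ)
      ≤ (1 + c) ^ 2 * poissonKernel 0 w (circleMap 0 ρ θ') := by
  have hρ0 : 0 < ρ := pos_of_mem_ball hw
  rw [mem_ball, dist_zero_right] at hw
  have hdist : ∀ t, ρ - ‖w‖ ≤ ‖circleMap 0 ρ t - w‖ := fun t ↦ by
    have := norm_sub_norm_le (circleMap 0 ρ t) w
    rwa [norm_circleMap_zero, abs_of_pos hρ0] at this
  have h1 : ‖circleMap 0 ρ θ' - circleMap 0 ρ θ‖ ≤ c * (ρ - ‖w‖) := by
    have h := (lipschitzWith_circleMap 0 ρ).dist_le_mul θ' θ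
    rw [dist_eq_norm, Real.dist_eq] at h
    refine (h.trans ?_).trans hθ
    rw [Real.coe_nnabs, abs_of_pos hρ0]
    exact mul_le_of_le_one_left (abs_nonneg _) hρ
  have h2 : ‖circleMap 0 ρ θ' - w‖ ≤ (1 + c) * ‖circleMap 0 ρ θ - w‖ := by
    have h3 := norm_sub_le_norm_sub_add_norm_sub (circleMap 0 ρ θ') (circleMap 0 ρ θ) w
    have h4 := mul_le_mul_of_nonneg_left (hdist θ) hc
    linarith
  have hd : 0 < ‖circleMap 0 ρ θ - w‖ := lt_of_lt_of_le (by linarith) (hdist θ)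
  have hd' : 0 < ‖circleMap 0 ρ θ' - w‖ := lt_of_lt_of_le (by linarith) (hdist θ')
  rw [poissonKernel_circleMap hρ0, poissonKernel_circleMap hρ0, mul_div_assoc',
    div_le_div_iff₀ (by positivity) (by positivity)]
  have hK : 0 ≤ ρ ^ 2 - ‖w‖ ^ 2 := by nlinarith [norm_nonneg w]
  have h5 : ‖circleMap 0 ρ θ' - w‖ ^ 2 ≤ ((1 + c) * ‖circleMap 0 ρ θ - w‖) ^ 2 := by gcongr
  calc (ρ ^ 2 - ‖w‖ ^ 2) * ‖circleMap 0 ρ θ' - w‖ ^ 2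
      ≤ (ρ ^ 2 - ‖w‖ ^ 2) * ((1 + c) * ‖circleMap 0 ρ θ - w‖) ^ 2 := by gcongr
    _ = _ := by ring

lemma abs_sub_le_of_mem_arc {N l : ℕ} {θ θ' : ℝ} (hθ : θ ∈ arc N l) (hθ' : θ' ∈ arc N l) :
    |θ' - θ| ≤ 2 * π / N := by
  have h := abs_sub_le_of_le_of_le hθ'.1 hθ'.2 hθ.1 hθ.2
  refine h.trans (le_of_eq ?_)
  ring

/-- Replacing a function on the circle by its averages over arcs on which Harnack's inequality
holds costs only a constant factor in the Poisson integral. -/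
lemma lintegral_poissonMeasure_le_sum {ρ c : ℝ} (hρ : ρ ≤ 1) (hc : 0 ≤ c) {w : ℂ}
    (hw : w ∈ ball (0 : ℂ) ρ) {N : ℕ} (hN : 0 < N) (hNc : 2 * π / N ≤ c * (ρ - ‖w‖))
    (F : ℝ → ℝ≥0∞) :
    ∫⁻ θ, F θ ∂poissonMeasure ρ w ≤ ENNReal.ofReal ((1 + c) ^ 2) * N *
      ∑ l : Fin N, poissonMeasure ρ w (arc N l) * ∫⁻ θ in arc N l, F θ ∂circleMeasure := by
  set P : ℝ → ℝ≥0∞ := fun θ ↦ ENNReal.ofReal (poissonKernel 0 w (circleMap 0 ρ θ)) with hP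
  have hPm : Measurable P := (continuous_poissonKernel_circleMap hw).measurable.ennreal_ofReal
  have hN0 : (N : ℝ≥0∞) ≠ 0 := by exact_mod_cast hN.ne'
  set c₀ := ENNReal.ofReal ((1 + c) ^ 2) with hc₀
  have hPle : ∀ l : Fin N, ∀ θ ∈ arc N l, P θ ≤ c₀ * N * poissonMeasure ρ w (arc N l) :=
    fun l θ hθ ↦ by
      have h1 : P θ * (N : ℝ≥0∞)⁻¹ ≤ c₀ * poissonMeasure ρ w (arc N l) := by
        calc P θ * (N : ℝ≥0∞)⁻¹ = ∫⁻ _ in arc N l, P θ ∂circleMeasure := by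
              rw [setLIntegral_const, circleMeasure_arc l.2]
          _ ≤ ∫⁻ θ' in arc N l, c₀ * P θ' ∂circleMeasure := by
              refine setLIntegral_mono (hPm.const_mul _) fun θ' hθ' ↦ ?_
              rw [hc₀, hP, ← ENNReal.ofReal_mul (by positivity)]
              exact ENNReal.ofReal_le_ofReal (poissonKernel_le_of_abs_sub_le hρ hc hw
                ((abs_sub_le_of_mem_arc hθ hθ').trans hNc))
          _ = c₀ * poissonMeasure ρ w (arc N l) := by
              rw [lintegral_const_mul _ hPm, poissonMeasure,
                withDensity_apply _ (measurableSet_arc N l)]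
      rw [← div_eq_mul_inv, ENNReal.div_le_iff hN0 (ENNReal.natCast_ne_top N)] at h1
      exact h1.trans (le_of_eq (by ring))
  rw [lintegral_poissonMeasure hw, ← sum_lintegral_arc hN, Finset.mul_sum]
  refine Finset.sum_le_sum fun l _ ↦ ?_
  have hκ : poissonMeasure ρ w (arc N l) ≠ ∞ :=
    have := isProbabilityMeasure_poissonMeasure hw
    measure_ne_top _ _
  calc ∫⁻ θ in arc N l, P θ * F θ ∂circleMeasure
      ≤ ∫⁻ θ in arc N l, c₀ * N * poissonMeasure ρ w (arc N l) * F θ ∂circleMeasure :=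
        setLIntegral_mono' (measurableSet_arc N l) fun θ hθ ↦ by gcongr; exact hPle l θ hθ
    _ = _ := by
        rw [lintegral_const_mul' _ _ (ENNReal.mul_ne_top
          (ENNReal.mul_ne_top ENNReal.ofReal_ne_top (ENNReal.natCast_ne_top N)) hκ), mul_assoc]

lemma poissonMeasure_arc (R : ℝ) (w : ℂ) (N l : ℕ) : poissonMeasure R w (arc N l)
    = ∫⁻ θ in arc N l, ENNReal.ofReal (poissonKernel 0 w (circleMap 0 R θ)) ∂circleMeasure :=
  withDensity_apply _ (measurableSet_arc N l)

lemma sum_poissonMeasure_arc {ρ : ℝ} {w : ℂ} (hw : w ∈ ball (0 : ℂ) ρ) {N : ℕ} (hN : 0 < N) :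
    ∑ l : Fin N, poissonMeasure ρ w (arc N l) = 1 := by
  have := isProbabilityMeasure_poissonMeasure hw
  have h := sum_lintegral_arc hN
    fun θ ↦ ENNReal.ofReal (poissonKernel 0 w (circleMap 0 ρ θ))
  simp_rw [← poissonMeasure_arc] at h
  rw [h, ← setLIntegral_univ, ← withDensity_apply _ MeasurableSet.univ]
  exact measure_univ (μ := poissonMeasure ρ w)

/-- The Poisson kernel depends only on the difference of the two angles, and is even in it. -/
lemma poissonKernel_circleMap_comm {r ρ : ℝ} (θ φ : ℝ) :
    poissonKernel 0 (circleMap 0 r φ) (circleMap 0 ρ θ)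
      = poissonKernel 0 (circleMap 0 r θ) (circleMap 0 ρ φ) := by
  have h : ∀ a b : ℝ, ‖circleMap 0 ρ a - circleMap 0 r b‖ ^ 2
      = ρ ^ 2 + r ^ 2 - 2 * ρ * r * Real.cos (a - b) := fun a b ↦ by
    rw [← normSq_eq_norm_sq, normSq_apply, sub_re, sub_im, circleMap_zero_re, circleMap_zero_re,
      circleMap_zero_im, circleMap_zero_im, Real.cos_sub]
    nlinarith [Real.sin_sq_add_cos_sq a, Real.sin_sq_add_cos_sq b]
  simp only [poissonKernel_def, sub_zero, norm_circleMap_zero, h]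
  rw [← Real.cos_neg (θ - φ), neg_sub]

lemma measurable_poissonKernel_circleMap (r ρ : ℝ) : Measurable fun x : ℝ × ℝ ↦
    ENNReal.ofReal (poissonKernel 0 (circleMap 0 r x.1) (circleMap 0 ρ x.2)) := by
  refine Measurable.ennreal_ofReal ?_
  simp only [poissonKernel_def, sub_zero]
  have h1 : Measurable fun x : ℝ × ℝ ↦ circleMap 0 r x.1 :=
    ((continuous_circleMap 0 r).comp continuous_fst).measurable
  have h2 : Measurable fun x : ℝ × ℝ ↦ circleMap 0 ρ x.2 :=
    ((continuous_circleMap 0 ρ).comp continuous_snd).measurable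
  exact ((h2.norm.pow_const 2).sub (h1.norm.pow_const 2)).div ((h2.sub h1).norm.pow_const 2)

lemma measurable_poissonMeasure_arc (r ρ : ℝ) (N l : ℕ) :
    Measurable fun φ ↦ poissonMeasure ρ (circleMap 0 r φ) (arc N l) := by
  simp_rw [poissonMeasure_arc]
  exact (measurable_poissonKernel_circleMap r ρ).lintegral_prod_right'

/-- The mean over the circle of radius `r` of the harmonic measure of an arc is the value of the
harmonic measure at the centre, that is, the normalized length of the arc. -/
lemma lintegral_poissonMeasure_arc {r ρ : ℝ} (hr : 0 ≤ r) (hrρ : r < ρ) {N l : ℕ} (hl : l < N) :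
    ∫⁻ φ, poissonMeasure ρ (circleMap 0 r φ) (arc N l) ∂circleMeasure = (N : ℝ≥0∞)⁻¹ := by
  have hball : ∀ φ, circleMap 0 r φ ∈ ball (0 : ℂ) ρ := fun φ ↦ by
    simp [abs_of_nonneg hr, hrρ]
  simp_rw [poissonMeasure_arc]
  rw [lintegral_lintegral_swap (measurable_poissonKernel_circleMap r ρ).aemeasurable]
  have h2 : ∀ θ, ∫⁻ φ, ENNReal.ofReal (poissonKernel 0 (circleMap 0 r φ) (circleMap 0 ρ θ))
      ∂circleMeasure = 1 := fun θ ↦ by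
    have := isProbabilityMeasure_poissonMeasure (hball θ)
    simp_rw [poissonKernel_circleMap_comm θ]
    rw [← setLIntegral_univ, ← withDensity_apply _ MeasurableSet.univ]
    exact measure_univ (μ := poissonMeasure ρ (circleMap 0 r θ))
  simp_rw [h2]
  rw [setLIntegral_one, circleMeasure_arc hl]

lemma floor_pos_and_le_two_mul {x : ℝ} (hx : 1 ≤ x) : 0 < ⌊x⌋₊ ∧ (⌊x⌋₊ : ℝ) ≤ x ∧ x ≤ 2 * ⌊x⌋₊ := by
  have h0 : 0 < ⌊x⌋₊ := Nat.floor_pos.2 hx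
  have h1 : (1 : ℝ) ≤ ⌊x⌋₊ := by exact_mod_cast h0
  exact ⟨h0, Nat.floor_le (by linarith), by linarith [Nat.lt_floor_add_one x]⟩

/-- The bound of `M_q(r, f)` by the norm of the boundary values on the circle of radius `ρ`, when
the `N` arcs are short enough for Harnack's inequality. By that inequality `|f|^p` is dominated by
the Poisson integral of a step function, which contracts the `L^(q/p)` norm. -/
lemma integralMean_le_lqNorm {p q : ℝ≥0∞} (hp0 : 0 < p) (hpq : p < q) {f : ℂ → ℂ} {r ρ c : ℝ}
    (hf : AnalyticInDisc f) (hr : 0 ≤ r) (hrρ : r < ρ) (hρ : ρ ≤ 1) (hρ1 : ρ = 1 → MemHardy p f)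
    (hc : 0 ≤ c) {N : ℕ} (hN : 0 < N) (hNc : 2 * π / N ≤ c * (ρ - r)) :
    integralMean q r f ≤ ENNReal.ofReal ((1 + c) ^ 2) ^ (1 / p.toReal)
      * (N : ℝ≥0∞) ^ (1 / p.toReal - 1 / q.toReal)
      * lqNorm q (fun l : Fin N ↦ localNorm p f ρ N l) := by
  have hp : p ≠ ∞ := hpq.ne_top
  have hp' : 0 < p.toReal := ENNReal.toReal_pos hp0.ne' hp
  have hN0 : (N : ℝ≥0∞) ≠ 0 := by exact_mod_cast hN.ne'
  have hNt : (N : ℝ≥0∞) ≠ ∞ := ENNReal.natCast_ne_top N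
  set c₀ := ENNReal.ofReal ((1 + c) ^ 2) with hc₀
  have hc₀t : c₀ ≠ ∞ := ENNReal.ofReal_ne_top
  set a : Fin N → ℝ≥0∞ := fun l ↦ localNorm p f ρ N l with ha
  have hball : ∀ w : ℂ, ‖w‖ = r → w ∈ ball (0 : ℂ) ρ := fun w hw ↦ by simp [hw, hrρ]
  -- the Poisson inequality for `|f|^p`, with the boundary function replaced by its arc averages
  have key : ∀ w : ℂ, ‖w‖ = r → ‖f w‖ₑ ^ p.toReal
      ≤ c₀ * N * ∑ l : Fin N, poissonMeasure ρ w (arc N l) * a l ^ p.toReal := fun w hw ↦ by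
    refine (enorm_rpow_le_lintegral_polarValue hp0 hp hf hρ hρ1 (hball w hw)).trans ?_
    refine (lintegral_poissonMeasure_le_sum hρ hc (hball w hw) hN (by rwa [hw]) _).trans
      (le_of_eq ?_)
    simp only [ha, hc₀, fun l : Fin N ↦ localNorm_rpow hp0 hp f ρ l.2]
  by_cases hq : q = ∞
  · subst hq
    rw [integralMean, if_pos rfl, lqNorm, if_pos rfl]
    simp only [ENNReal.toReal_top, div_zero, sub_zero]
    rw [← ENNReal.mul_rpow_of_nonneg _ _ (by positivity)]
    refine iSup₂_le fun w hw ↦ ?_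
    have hw' : ‖w‖ = r := by simpa using hw
    have h1 : ‖f w‖ₑ ^ p.toReal ≤ c₀ * N * (⨆ l, a l) ^ p.toReal := by
      refine (key w hw').trans ?_
      gcongr
      calc ∑ l : Fin N, poissonMeasure ρ w (arc N l) * a l ^ p.toReal
          ≤ ∑ l : Fin N, poissonMeasure ρ w (arc N l) * (⨆ l, a l) ^ p.toReal := by
            gcongr with l
            exact le_iSup a l
        _ = (⨆ l, a l) ^ p.toReal := by
            rw [← Finset.sum_mul, sum_poissonMeasure_arc (hball w hw') hN, one_mul]
    rw [← ENNReal.le_rpow_inv_iff hp', ENNReal.mul_rpow_of_nonneg _ _ (by positivity),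
      ← ENNReal.rpow_mul, mul_inv_cancel₀ hp'.ne', ENNReal.rpow_one] at h1
    rwa [one_div]
  · have hpq' : p.toReal < q.toReal := (ENNReal.toReal_lt_toReal hp hq).2 hpq
    have hq' : 0 < q.toReal := hp'.trans hpq'
    set s := q.toReal / p.toReal with hs
    have hs1 : 1 ≤ s := (one_le_div hp').2 hpq'.le
    have hps : p.toReal * s = q.toReal := mul_div_cancel₀ _ hp'.ne'
    -- the weights add up to `1`, so Jensen's inequality for `x ^ (q / p)` applies
    have keyq : ∀ φ, ‖f (circleMap 0 r φ)‖ₑ ^ q.toReal ≤ (c₀ * N) ^ s *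
        ∑ l : Fin N, poissonMeasure ρ (circleMap 0 r φ) (arc N l) * a l ^ q.toReal := fun φ ↦ by
      have hw : ‖circleMap 0 r φ‖ = r := by simp [abs_of_nonneg hr]
      rw [← hps, ENNReal.rpow_mul]
      refine (ENNReal.rpow_le_rpow (key _ hw) (by positivity)).trans ?_
      rw [ENNReal.mul_rpow_of_nonneg _ _ (by positivity)]
      gcongr
      refine (ENNReal.rpow_arith_mean_le_arith_mean_rpow _ _ _
        (sum_poissonMeasure_arc (hball _ hw) hN) hs1).trans (le_of_eq ?_)
      simp only [ENNReal.rpow_mul]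
    have hmeas : ∀ l : Fin N, Measurable fun φ ↦ poissonMeasure ρ (circleMap 0 r φ) (arc N l) :=
      fun l ↦ measurable_poissonMeasure_arc r ρ N l
    have hint : ∫⁻ φ, ‖f (circleMap 0 r φ)‖ₑ ^ q.toReal ∂circleMeasure
        ≤ (c₀ * N) ^ s * ((N : ℝ≥0∞)⁻¹ * ∑ l, a l ^ q.toReal) := by
      refine (lintegral_mono keyq).trans (le_of_eq ?_)
      rw [lintegral_const_mul' _ _ (ENNReal.rpow_ne_top_of_nonneg (by positivity)
        (ENNReal.mul_ne_top hc₀t hNt)), lintegral_finsetSum _ fun l _ ↦ (hmeas l).mul_const _]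
      congr 1
      rw [Finset.mul_sum]
      refine Finset.sum_congr rfl fun l _ ↦ ?_
      rw [lintegral_mul_const _ (hmeas l), lintegral_poissonMeasure_arc hr hrρ l.2]
    rw [integralMean_eq hq, lqNorm, if_neg hq]
    refine (ENNReal.rpow_le_rpow hint (by positivity)).trans (le_of_eq ?_)
    have hsq : s * (1 / q.toReal) = 1 / p.toReal := by rw [hs]; field_simp
    rw [ENNReal.mul_rpow_of_nonneg _ _ (by positivity), ← ENNReal.rpow_mul, hsq,
      ENNReal.mul_rpow_of_nonneg _ _ (by positivity), ENNReal.mul_rpow_of_nonneg _ _ (by positivity),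
      ENNReal.rpow_sub _ _ hN0 hNt, ENNReal.inv_rpow]
    simp only [div_eq_mul_inv]
    ring

/-- The choice `N = ⌊1 / (ρ - r)⌋`: since `1 / (ρ - r) ≤ 2 N`, the arcs have length at most
`4π (ρ - r)`, and `N ≤ 1 / (ρ - r)` turns the power of `N` into the power of `ρ - r`. -/
theorem integralMean_le_amalgamNorm {p q : ℝ≥0∞} (hp0 : 0 < p) (hpq : p < q) :
    ∃ C : ℝ, 0 < C ∧ ∀ f : ℂ → ℂ, AnalyticInDisc f →
      ∀ r ρ : ℝ, 0 ≤ r → r < ρ → ρ ≤ 1 → (ρ = 1 → MemHardy p f) →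
        integralMean q r f ≤ ENNReal.ofReal (C / (ρ - r) ^ (1 / p.toReal - 1 / q.toReal)) *
          amalgamNorm p q f ρ ⌊1 / (ρ - r)⌋₊ := by
  have hα := one_div_toReal_sub_pos hp0 hpq
  have hπ := Real.pi_pos
  refine ⟨((1 + 4 * π) ^ 2) ^ (1 / p.toReal), by positivity, fun f hf r ρ hr hrρ hρ hρ1 ↦ ?_⟩
  have hη : 0 < ρ - r := by linarith
  obtain ⟨hN, hN1, hN2⟩ := floor_pos_and_le_two_mul ((one_le_div hη).2 (by linarith : ρ - r ≤ 1))
  set N := ⌊1 / (ρ - r)⌋₊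
  have hN' : (0 : ℝ) < N := by exact_mod_cast hN
  have hNc : 2 * π / N ≤ 4 * π * (ρ - r) := by
    rw [div_le_iff₀ hη] at hN2
    rw [div_le_iff₀ hN']
    nlinarith
  rw [amalgamNorm, if_neg fun h ↦ h.2 (hasBoundaryValues hp0 hpq.ne_top (hρ1 h.1))]
  refine (integralMean_le_lqNorm hp0 hpq hf hr hrρ hρ hρ1 (by positivity) hN hNc).trans ?_
  gcongr
  rw [ENNReal.ofReal_rpow_of_nonneg (by positivity) (by positivity), ← ENNReal.ofReal_natCast,
    ENNReal.ofReal_rpow_of_pos hN', ← ENNReal.ofReal_mul (by positivity)]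
  refine ENNReal.ofReal_le_ofReal ?_
  rw [div_eq_mul_inv _ ((ρ - r) ^ _), ← Real.inv_rpow hη.le, ← one_div (ρ - r)]
  gcongr

end HardyAmalgam

theorem theorem1 (p q : ℝ≥0∞) (hp : 0 < p) (hpq : p < q) :
    (∃ C : ℝ, 0 < C ∧ ∀ f : ℂ → ℂ, HardyAmalgam.AnalyticInDisc f →
      ∀ r ρ : ℝ, 0 ≤ r → r < ρ → ρ ≤ 1 → (ρ = 1 → HardyAmalgam.MemHardy p f) →
        HardyAmalgam.integralMean q r f ≤
          ENNReal.ofReal (C / (ρ - r) ^ (1 / p.toReal - 1 / q.toReal)) *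
            HardyAmalgam.amalgamNorm p q f ρ ⌊1 / (ρ - r)⌋₊) ∧
    (∀ N : ℕ, 0 < N → ∀ f : ℂ → ℂ, HardyAmalgam.MemHardy p f →
      HardyAmalgam.amalgamNorm p q f 1 N ≤ HardyAmalgam.hardyNorm p f) ∧
    (∀ K : ℝ≥0, ∃ f : ℂ → ℂ, ∃ N : ℕ, HardyAmalgam.MemHardy p f ∧ 0 < N ∧
      HardyAmalgam.amalgamNorm p q f 1 N ≠ 0 ∧
      (K : ℝ≥0∞) < HardyAmalgam.hardyNorm p f / HardyAmalgam.amalgamNorm p q f 1 N) :=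
  ⟨HardyAmalgam.integralMean_le_amalgamNorm hp hpq,
    fun _ hN _ hf ↦ HardyAmalgam.amalgamNorm_le_hardyNorm hp hpq hN hf,
    HardyAmalgam.exists_lt_hardyNorm_div_amalgamNorm hp hpq⟩
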